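/- Let $k$ be an algebraically closed field of characteristic zero. Let $H(2)$ be the group algebra $k[C_2]$, $C_2=\langle g\rangle$, with its usual comultiplication and counit, viewed as a quasi-Hopf algebra with reassociator $\Phi_2=1\otimes 1\otimes 1-2\,p_-\otimes p_-\otimes p_-$, where $p_\pm=\frac12(1\pm g)$, with antipode the identity and distinguished elements $\alpha=g$, $\beta=1$. Let ${}_{H(2)}^{H(2)}\mathcal{YD}$ be the braided monoidal category of left Yetter–Drinfeld modules over $H(2)$, and consider the following two Hopf algebras in it, both having the group Hopf algebra $k[C_3]$ as underlying algebra and coalgebra and the trivial $H(2)$-action $h\cdot b=\varepsilon(h)b$: - $B_{C_6}$, with the trivial coaction $\lambda(b)=1\otimes b$; - $B_*$, with the coaction determined by $\lambda(x)=p_+\otimes x+p_-\otimes x^2$ for all $x\in C_3$. Then every Hopf algebra $B$ in ${}_{H(2)}^{H(2)}\mathcal{YD}$ with $\dim_k B=3$ is isomorphic, as a Hopf algebra in ${}_{H(2)}^{H(2)}\mathcal{YD}$, to $B_{C_6}$ or to $B_*$. In particular, $H(2)$ acts trivially on $B$, that is, $h\cdot b=\varepsilon(h)b$ for all $h\in H(2)$,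 $b\in B$. -/

import Mathlib

open scoped TensorProduct

set_option linter.unusedSectionVars false

noncomputable section

namespace QuasiHopf

universe u v w

/-! ### Quasi-bialgebras and quasi-Hopf algebras -/

/-- A quasi-bialgebra structure on the `k`-algebra `H`. The threefold (fourfold) tensor powers
are bracketed to the right. -/
structure QuasiBialgebra (k : Type u) (H : Type v) [CommRing k] [Ring H] [Algebra k H] where
  comul : H →ₐ[k] H ⊗[k] H
  counit : H →ₐ[k] k
  /-- the reassociator `Φ = X¹ ⊗ X² ⊗ X³`, with inverse `x¹ ⊗ x² ⊗ x³` -/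
  reassoc : (H ⊗[k] (H ⊗[k] H))ˣ
  /-- `(id ⊗ Δ)(Δ h) = Φ (Δ ⊗ id)(Δ h) Φ⁻¹` -/
  quasi_coassoc : ∀ h : H,
    Algebra.TensorProduct.map (AlgHom.id k H) comul (comul h) =
      (reassoc : H ⊗[k] (H ⊗[k] H)) *
        Algebra.TensorProduct.assoc k k k H H H
          (Algebra.TensorProduct.map comul (AlgHom.id k H) (comul h)) *
        ((reassoc⁻¹ : (H ⊗[k] (H ⊗[k] H))ˣ) : H ⊗[k] (H ⊗[k] H))
  /-- `(id ⊗ ε)(Δ h) = h` -/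
  counit_right : ∀ h : H,
    TensorProduct.rid k H (TensorProduct.map LinearMap.id counit.toLinearMap (comul h)) = h
  /-- `(ε ⊗ id)(Δ h) = h` -/
  counit_left : ∀ h : H,
    TensorProduct.lid k H (TensorProduct.map counit.toLinearMap LinearMap.id (comul h)) = h
  /-- `(1 ⊗ Φ) (id ⊗ Δ ⊗ id)(Φ) (Φ ⊗ 1) = (id ⊗ id ⊗ Δ)(Φ) (Δ ⊗ id ⊗ id)(Φ)` -/
  cocycle :
    ((1 : H) ⊗ₜ[k] (reassoc : H ⊗[k] (H ⊗[k] H))) *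
      TensorProduct.map LinearMap.id
        ((TensorProduct.assoc k H H H).toLinearMap ∘ₗ
          TensorProduct.map comul.toLinearMap LinearMap.id)
        (reassoc : H ⊗[k] (H ⊗[k] H)) *
      TensorProduct.map LinearMap.id (TensorProduct.assoc k H H H).toLinearMap
        (TensorProduct.assoc k H (H ⊗[k] H) H
          ((reassoc : H ⊗[k] (H ⊗[k] H)) ⊗ₜ[k] (1 : H))) =
    TensorProduct.map LinearMap.id (TensorProduct.map LinearMap.id comul.toLinearMap)
        (reassoc : H ⊗[k] (H ⊗[k] H)) *
      TensorProduct.assoc k H H (H ⊗[k] H)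
        (TensorProduct.map comul.toLinearMap LinearMap.id (reassoc : H ⊗[k] (H ⊗[k] H)))
  /-- `(id ⊗ ε ⊗ id)(Φ) = 1 ⊗ 1` -/
  cocycle_normalized :
    TensorProduct.map LinearMap.id
      ((TensorProduct.lid k H).toLinearMap ∘ₗ
        TensorProduct.map counit.toLinearMap LinearMap.id)
      (reassoc : H ⊗[k] (H ⊗[k] H)) = 1

/-- A quasi-Hopf algebra structure on the `k`-algebra `H`: a quasi-bialgebra with an algebra
anti-endomorphism `S` (the antipode) and distinguished elements `α`, `β`. -/
structure QuasiHopfAlgebra (k : Type u) (H : Type v) [CommRing k] [Ring H] [Algebra k H]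
    extends QuasiBialgebra k H where
  antipode : H →ₗ[k] H
  antipode_one : antipode 1 = 1
  antipode_mul : ∀ a b : H, antipode (a * b) = antipode b * antipode a
  α : H
  β : H
  /-- `S(h₁) α h₂ = ε(h) α` -/
  antipode_left : ∀ h : H,
    LinearMap.mul' k H (TensorProduct.map (LinearMap.mulRight k α ∘ₗ antipode) LinearMap.id
      (comul h)) = counit h • α
  /-- `h₁ β S(h₂) = ε(h) β` -/
  antipode_right : ∀ h : H,
    LinearMap.mul' k H (TensorProduct.map (LinearMap.mulRight k β) antipode
      (comul h)) = counit h • β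
  /-- `X¹ β S(X²) α X³ = 1` -/
  antipode_reassoc :
    LinearMap.mul' k H (TensorProduct.map (LinearMap.mulRight k β)
      (LinearMap.mul' k H ∘ₗ
        TensorProduct.map (LinearMap.mulRight k α ∘ₗ antipode) LinearMap.id)
      (reassoc : H ⊗[k] (H ⊗[k] H))) = 1
  /-- `S(x¹) α x² β S(x³) = 1` -/
  antipode_reassoc_inv :
    LinearMap.mul' k H (TensorProduct.map (LinearMap.mulRight k α ∘ₗ antipode)
      (LinearMap.mul' k H ∘ₗ TensorProduct.map (LinearMap.mulRight k β) antipode)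
      ((reassoc⁻¹ : (H ⊗[k] (H ⊗[k] H))ˣ) : H ⊗[k] (H ⊗[k] H))) = 1

/-! ### Modules over a quasi-bialgebra

A left `H`-module structure on a `k`-module `M` is an algebra map `ρ : H →ₐ[k] Module.End k M`. -/

section Modules

variable {k : Type u} [CommRing k]

/-- The action of `H ⊗ H'` on `M ⊗ N`: `(h ⊗ h') · (m ⊗ n) = h · m ⊗ h' · n`. -/
def pairAct {H H' M N : Type*} [Ring H] [Algebra k H] [Ring H'] [Algebra k H']
    [AddCommGroup M] [Module k M] [AddCommGroup N] [Module k N]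
    (ρ : H →ₐ[k] Module.End k M) (σ : H' →ₐ[k] Module.End k N) :
    H ⊗[k] H' →ₐ[k] Module.End k (M ⊗[k] N) :=
  (Module.endTensorEndAlgHom (R := k) (S := k) (A := k) (M := M) (N := N)).comp
    (Algebra.TensorProduct.map ρ σ)

theorem pairAct_tmul {H H' M N : Type*} [Ring H] [Algebra k H] [Ring H'] [Algebra k H']
    [AddCommGroup M] [Module k M] [AddCommGroup N] [Module k N]
    (ρ : H →ₐ[k] Module.End k M) (σ : H' →ₐ[k] Module.End k N) (h : H) (h' : H') (m : M) (n : N) :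
    pairAct ρ σ (h ⊗ₜ h') (m ⊗ₜ n) = ρ h m ⊗ₜ σ h' n := rfl

variable {H M N P : Type*} [Ring H] [Algebra k H] [AddCommGroup M] [Module k M]
  [AddCommGroup N] [Module k N] [AddCommGroup P] [Module k P]

/-- The left regular action of `H` on itself. -/
def regAct (k : Type u) [CommRing k] (H : Type*) [Ring H] [Algebra k H] :
    H →ₐ[k] Module.End k H :=
  Algebra.lmul k H

theorem regAct_apply (a b : H) : regAct k H a b = a * b := rfl

/-- For a map `lam : M → H ⊗ M`, `m ↦ m₍₋₁₎ ⊗ m₍₀₎`, and a left `H`-module `N`, the map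
`M ⊗ N → N ⊗ M`, `m ⊗ n ↦ m₍₋₁₎ · n ⊗ m₍₀₎`. For Yetter-Drinfeld modules this is the braiding;
for `N = H` (regular action) it is `m ⊗ h ↦ m₍₋₁₎ h ⊗ m₍₀₎`. -/
def braid (lam : M →ₗ[k] H ⊗[k] M) (σ : H →ₐ[k] Module.End k N) :
    M ⊗[k] N →ₗ[k] N ⊗[k] M :=
  TensorProduct.map (TensorProduct.lift σ.toLinearMap) LinearMap.id ∘ₗ
    (TensorProduct.rightComm k H M N).toLinearMap ∘ₗ
    TensorProduct.map lam LinearMap.id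

theorem braid_of_sum (lam : M →ₗ[k] H ⊗[k] M) (σ : H →ₐ[k] Module.End k N)
    {m m₁ m₂ : M} {a b : H} (h : lam m = a ⊗ₜ m₁ + b ⊗ₜ m₂) (n : N) :
    braid lam σ (m ⊗ₜ n) = σ a n ⊗ₜ m₁ + σ b n ⊗ₜ m₂ := by
  simp [braid, h, TensorProduct.add_tmul]

namespace QuasiBialgebra

variable (Q : QuasiBialgebra k H)

/-- The action of `H` on `M ⊗ N`: `h · (m ⊗ n) = h₁ · m ⊗ h₂ · n`. -/
def tensorAct (ρ : H →ₐ[k] Module.End k M) (σ : H →ₐ[k] Module.End k N) :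
    H →ₐ[k] Module.End k (M ⊗[k] N) :=
  (pairAct ρ σ).comp Q.comul

/-- The associativity constraint of the category of left `H`-modules:
`(m ⊗ n) ⊗ p ↦ X¹ · m ⊗ (X² · n ⊗ X³ · p)`. -/
def associator (ρ : H →ₐ[k] Module.End k M) (σ : H →ₐ[k] Module.End k N)
    (τ : H →ₐ[k] Module.End k P) : (M ⊗[k] N) ⊗[k] P →ₗ[k] M ⊗[k] (N ⊗[k] P) :=
  (pairAct ρ (pairAct σ τ) (Q.reassoc : H ⊗[k] (H ⊗[k] H))) ∘ₗ
    (TensorProduct.assoc k M N P).toLinearMap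

/-- The inverse of the associativity constraint:
`m ⊗ (n ⊗ p) ↦ (x¹ · m ⊗ x² · n) ⊗ x³ · p`. -/
def associatorInv (ρ : H →ₐ[k] Module.End k M) (σ : H →ₐ[k] Module.End k N)
    (τ : H →ₐ[k] Module.End k P) : M ⊗[k] (N ⊗[k] P) →ₗ[k] (M ⊗[k] N) ⊗[k] P :=
  (TensorProduct.assoc k M N P).symm.toLinearMap ∘ₗ
    (pairAct ρ (pairAct σ τ) ((Q.reassoc⁻¹ : (H ⊗[k] (H ⊗[k] H))ˣ) : H ⊗[k] (H ⊗[k] H)))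

/-- The coaction on the tensor product of two Yetter-Drinfeld modules:
`m ⊗ n ↦ X¹ (x¹Y¹ · m)₍₋₁₎ x² (Y² · n)₍₋₁₎ Y³ ⊗ X² · (x¹Y¹ · m)₍₀₎ ⊗ X³x³ · (Y² · n)₍₀₎`. -/
def tensorCoact (ρ : H →ₐ[k] Module.End k M) (lam : M →ₗ[k] H ⊗[k] M)
    (σ : H →ₐ[k] Module.End k N) (mu : N →ₗ[k] H ⊗[k] N) :
    M ⊗[k] N →ₗ[k] H ⊗[k] (M ⊗[k] N) :=
  Q.associator (regAct k H) ρ σ ∘ₗ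
    TensorProduct.map (braid lam (regAct k H)) LinearMap.id ∘ₗ
    Q.associatorInv ρ (regAct k H) σ ∘ₗ
    TensorProduct.map LinearMap.id (braid mu (regAct k H)) ∘ₗ
    Q.associator ρ σ (regAct k H) ∘ₗ
    (TensorProduct.mk k (M ⊗[k] N) H).flip 1

/-- The middle four interchange `(M ⊗ M) ⊗ (M ⊗ M) → (M ⊗ M) ⊗ (M ⊗ M)` of a Yetter-Drinfeld
module `M`, which braids the two middle factors:
`(a ⊗ b) ⊗ (a' ⊗ b') ↦ (y¹X¹ · a ⊗ y²Y¹(x¹X² · b)₍₋₁₎x²X³₁ · a') ⊗`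
`(y³₁Y² · (x¹X² · b)₍₀₎ ⊗ y³₂Y³x³X³₂ · b')`. -/
def interchange (ρ : H →ₐ[k] Module.End k M) (lam : M →ₗ[k] H ⊗[k] M) :
    (M ⊗[k] M) ⊗[k] (M ⊗[k] M) →ₗ[k] (M ⊗[k] M) ⊗[k] (M ⊗[k] M) :=
  Q.associatorInv ρ ρ (Q.tensorAct ρ ρ) ∘ₗ
    TensorProduct.map LinearMap.id
      (Q.associator ρ ρ ρ ∘ₗ
        TensorProduct.map (braid lam ρ) LinearMap.id ∘ₗ
        Q.associatorInv ρ ρ ρ) ∘ₗ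
    Q.associator ρ ρ (Q.tensorAct ρ ρ)

end QuasiBialgebra

end Modules

/-! ### Yetter-Drinfeld modules and Hopf algebras in their category -/

section YetterDrinfeld

variable {k : Type u} [CommRing k] {H : Type v} [Ring H] [Algebra k H]

/-- A left Yetter-Drinfeld module structure over the quasi-bialgebra `Q` on `M`. -/
structure YDModule (Q : QuasiBialgebra k H) (M : Type w) [AddCommGroup M] [Module k M] where
  act : H →ₐ[k] Module.End k M
  /-- the coaction `m ↦ m₍₋₁₎ ⊗ m₍₀₎` -/
  coact : M →ₗ[k] H ⊗[k] M
  /-- `ε(m₍₋₁₎) m₍₀₎ = m` -/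
  coact_counit : ∀ m : M,
    TensorProduct.lid k M (TensorProduct.map Q.counit.toLinearMap LinearMap.id (coact m)) = m
  /-- `X¹m₍₋₁₎ ⊗ (X² · m₍₀₎)₍₋₁₎X³ ⊗ (X² · m₍₀₎)₍₀₎ =`
  `X¹((Y¹ · m)₍₋₁₎)₁Y² ⊗ X²((Y¹ · m)₍₋₁₎)₂Y³ ⊗ X³ · (Y¹ · m)₍₀₎` -/
  coact_coassoc : ∀ m : M,
    TensorProduct.map LinearMap.id (braid coact (regAct k H))
        (Q.associator (regAct k H) act (regAct k H) (coact m ⊗ₜ[k] (1 : H))) =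
      Q.associator (regAct k H) (regAct k H) act
        (braid coact (Q.tensorAct (regAct k H) (regAct k H))
          (Q.associator act (regAct k H) (regAct k H) ((m ⊗ₜ[k] (1 : H)) ⊗ₜ[k] (1 : H))))
  /-- `h₁m₍₋₁₎ ⊗ h₂ · m₍₀₎ = (h₁ · m)₍₋₁₎h₂ ⊗ (h₁ · m)₍₀₎` -/
  act_coact : ∀ (h : H) (m : M),
    Q.tensorAct (regAct k H) act h (coact m) =
      braid coact (regAct k H) (Q.tensorAct act (regAct k H) h (m ⊗ₜ[k] (1 : H)))

/-- A Hopf algebra in the category of left Yetter-Drinfeld modules over `Q`, with underlying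
`k`-module `B`. -/
structure YDHopfAlgebra (Q : QuasiBialgebra k H) (B : Type w) [AddCommGroup B] [Module k B]
    extends YDModule Q B where
  mul : B ⊗[k] B →ₗ[k] B
  one : B
  comul : B →ₗ[k] B ⊗[k] B
  counit : B →ₗ[k] k
  /- the algebra structure -/
  one_mul : ∀ b : B, mul (one ⊗ₜ[k] b) = b
  mul_one : ∀ b : B, mul (b ⊗ₜ[k] one) = b
  /-- `h · (bb') = (h₁ · b)(h₂ · b')` -/
  act_mul : ∀ (h : H) (t : B ⊗[k] B), act h (mul t) = mul (Q.tensorAct act act h t)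
  act_one : ∀ h : H, act h one = Q.counit h • one
  /-- `(bb')b'' = (X¹ · b)[(X² · b')(X³ · b'')]` -/
  mul_assoc : ∀ t : (B ⊗[k] B) ⊗[k] B,
    mul (TensorProduct.map mul LinearMap.id t) =
      mul (TensorProduct.map LinearMap.id mul (Q.associator act act act t))
  coact_one : coact one = (1 : H) ⊗ₜ[k] one
  /-- the multiplication is colinear -/
  coact_mul : ∀ t : B ⊗[k] B,
    coact (mul t) = TensorProduct.map LinearMap.id mul (Q.tensorCoact act coact act coact t)
  /- the coalgebra structure -/
  counit_left : ∀ b : B,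
    TensorProduct.lid k B (TensorProduct.map counit LinearMap.id (comul b)) = b
  counit_right : ∀ b : B,
    TensorProduct.rid k B (TensorProduct.map LinearMap.id counit (comul b)) = b
  /-- `Δ(h · b) = h₁ · b₁ ⊗ h₂ · b₂` -/
  comul_act : ∀ (h : H) (b : B), comul (act h b) = Q.tensorAct act act h (comul b)
  counit_act : ∀ (h : H) (b : B), counit (act h b) = Q.counit h * counit b
  /-- `X¹ · b₁₁ ⊗ X² · b₁₂ ⊗ X³ · b₂ = b₁ ⊗ b₂₁ ⊗ b₂₂` -/
  coassoc : ∀ b : B,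
    Q.associator act act act (TensorProduct.map comul LinearMap.id (comul b)) =
      TensorProduct.map LinearMap.id comul (comul b)
  /-- the comultiplication is colinear -/
  coact_comul : ∀ b : B,
    TensorProduct.map LinearMap.id comul (coact b) =
      Q.tensorCoact act coact act coact (comul b)
  /-- `ε(b₍₀₎) b₍₋₁₎ = ε(b) 1` -/
  coact_counit' : ∀ b : B,
    TensorProduct.rid k H (TensorProduct.map LinearMap.id counit (coact b)) =
      counit b • (1 : H)
  /- the comultiplication and the counit are algebra morphisms -/
  comul_one : comul one = one ⊗ₜ[k] one
  counit_one : counit one = 1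
  counit_mul : ∀ b b' : B, counit (mul (b ⊗ₜ[k] b')) = counit b * counit b'
  /-- `Δ(bb') = Δ(b)Δ(b')` in the braided tensor product algebra `B ⊗ B` -/
  comul_mul : ∀ b b' : B,
    comul (mul (b ⊗ₜ[k] b')) =
      TensorProduct.map mul mul (Q.interchange act coact (comul b ⊗ₜ[k] comul b'))
  /-- there is an antipode, a linear and colinear map `S` with
  `S(b₁)b₂ = ε(b)1 = b₁S(b₂)` -/
  exists_antipode : ∃ S : B →ₗ[k] B,
    (∀ (h : H) (b : B), S (act h b) = act h (S b)) ∧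
    (∀ b : B, coact (S b) = TensorProduct.map LinearMap.id S (coact b)) ∧
    (∀ b : B, mul (TensorProduct.map S LinearMap.id (comul b)) = counit b • one) ∧
    (∀ b : B, mul (TensorProduct.map LinearMap.id S (comul b)) = counit b • one)

/-- An isomorphism of Hopf algebras in the category of left Yetter-Drinfeld modules over `Q`. -/
structure YDHopfIso {Q : QuasiBialgebra k H} {B : Type*} [AddCommGroup B] [Module k B]
    {C : Type*} [AddCommGroup C] [Module k C] (X : YDHopfAlgebra Q B) (Y : YDHopfAlgebra Q C)
    extends B ≃ₗ[k] C where
  map_act : ∀ (h : H) (b : B), toLinearEquiv (X.act h b) = Y.act h (toLinearEquiv b)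
  map_coact : ∀ b : B,
    Y.coact (toLinearEquiv b) =
      TensorProduct.map LinearMap.id toLinearEquiv.toLinearMap (X.coact b)
  map_mul : ∀ b b' : B,
    toLinearEquiv (X.mul (b ⊗ₜ[k] b')) =
      Y.mul (toLinearEquiv b ⊗ₜ[k] toLinearEquiv b')
  map_one : toLinearEquiv X.one = Y.one
  map_comul : ∀ b : B,
    Y.comul (toLinearEquiv b) =
      TensorProduct.map toLinearEquiv.toLinearMap toLinearEquiv.toLinearMap (X.comul b)
  map_counit : ∀ b : B, Y.counit (toLinearEquiv b) = X.counit b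

end YetterDrinfeld

/-! ### The quasi-Hopf algebra `H(2)` -/

section HTwo

/-- The group algebra `k[C₂]`. -/
def KC2 (k : Type u) [Field k] : Type u := MonoidAlgebra k (Multiplicative (ZMod 2))

instance (k : Type u) [Field k] : CommRing (KC2 k) :=
  inferInstanceAs (CommRing (MonoidAlgebra k (Multiplicative (ZMod 2))))

instance (k : Type u) [Field k] : Bialgebra k (KC2 k) :=
  inferInstanceAs (Bialgebra k (MonoidAlgebra k (Multiplicative (ZMod 2))))

variable (k : Type u) [Field k]

/-- The generator of `C₂` in `k[C₂]`. -/
def g : KC2 k :=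
  (MonoidAlgebra.single (Multiplicative.ofAdd 1) 1 : MonoidAlgebra k (Multiplicative (ZMod 2)))

/-- `p₊ = (1 + g) / 2` -/
def pPlus : KC2 k := (2 : k)⁻¹ • (1 + g k)

/-- `p₋ = (1 - g) / 2` -/
def pMinus : KC2 k := (2 : k)⁻¹ • (1 - g k)

/-- `Φ₂ = 1 ⊗ 1 ⊗ 1 - 2 p₋ ⊗ p₋ ⊗ p₋` -/
def Phi2 : KC2 k ⊗[k] (KC2 k ⊗[k] KC2 k) :=
  1 - (2 : k) • (pMinus k ⊗ₜ[k] (pMinus k ⊗ₜ[k] pMinus k))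

theorem g_mul_g : g k * g k = 1 := by
  refine (MonoidAlgebra.single_mul_single ..).trans ?_
  rw [one_mul]
  rfl

theorem comul_g : Coalgebra.comul (R := k) (g k) = g k ⊗ₜ[k] g k := by
  refine (MonoidAlgebra.comul_single ..).trans ?_
  rw [CommSemiring.comul_apply, TensorProduct.map_tmul]
  rfl

theorem counit_g : Coalgebra.counit (R := k) (g k) = 1 :=
  (MonoidAlgebra.counit_single ..).trans rfl

theorem KC2.hom_ext {M : Type*} [AddCommGroup M] [Module k M] {f f' : KC2 k →ₗ[k] M}
    (h1 : f 1 = f' 1) (hg : f (g k) = f' (g k)) : f = f' := by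
  refine MonoidAlgebra.lhom_ext' (S := k) (R := k) (M := Multiplicative (ZMod 2)) fun x => ?_
  refine LinearMap.ext_ring ?_
  have hx : x = 1 ∨ x = Multiplicative.ofAdd 1 := by revert x; decide
  rcases hx with rfl | rfl
  · exact h1
  · exact hg

theorem counit_pMinus : Coalgebra.counit (R := k) (pMinus k) = 0 := by
  simp [pMinus, counit_g]

variable [CharZero k]

theorem pMinus_mul : pMinus k * pMinus k = pMinus k := by
  have h2 : (2 : k) ≠ 0 := two_ne_zero
  simp only [pMinus, smul_mul_smul_comm, sub_mul, mul_sub, g_mul_g, one_mul, mul_one]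
  rw [show (1 : KC2 k) - g k - (g k - 1) = (2 : k) • (1 - g k) by rw [two_smul]; abel, smul_smul]
  congr 1; field_simp

theorem Phi2_mul : Phi2 k * Phi2 k = 1 := by
  simp only [Phi2, mul_sub, sub_mul, one_mul, mul_one, smul_mul_smul_comm,
    Algebra.TensorProduct.tmul_mul_tmul, pMinus_mul]
  module

theorem g_eq : g k = 1 - (2 : k) • pMinus k := by
  rw [pMinus, smul_smul, mul_inv_cancel₀ two_ne_zero, one_smul]; abel

theorem comul_pMinus : Coalgebra.comul (R := k) (pMinus k) =
    1 ⊗ₜ[k] pMinus k + pMinus k ⊗ₜ[k] 1 - (2 : k) • pMinus k ⊗ₜ[k] pMinus k := by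
  rw [pMinus, map_smul, map_sub, comul_g, Bialgebra.comul_one, Algebra.TensorProduct.one_def,
    g_eq]
  have h2 : (2 : k) ≠ 0 := two_ne_zero
  simp only [TensorProduct.tmul_sub, TensorProduct.sub_tmul, TensorProduct.tmul_smul,
    ← TensorProduct.smul_tmul', sub_sub_cancel, smul_smul, inv_mul_cancel₀ h2, one_smul]
  match_scalars <;> field_simp
  ring

theorem units_conj {R : Type*} [CommRing R] (u : Rˣ) (x : R) :
    (u : R) * x * ((u⁻¹ : Rˣ) : R) = x := by
  rw [mul_right_comm, Units.mul_inv, one_mul]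

theorem prod_aux {k A : Type*} [Field k] [Ring A] [Algebra k A] {o x y z w v : A}
    (ho : o = 1) (h1 : x * y = w) (h2 : x * z = w) (h3 : x * w = w) (h4 : x * v = w)
    (h5 : y * v = w) (h6 : z * v = w) (h7 : w * v = w) :
    (o - (2 : k) • x) * (o - (2 : k) • (y + z - (2 : k) • w)) * (o - (2 : k) • v) =
      o - (2 : k) • x - (2 : k) • y - (2 : k) • z - (2 : k) • v + (8 : k) • w := by
  subst ho
  simp only [mul_sub, sub_mul, mul_add, add_mul, smul_mul_assoc, mul_smul_comm, one_mul, mul_one,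
    h1, h2, h3, h4, h5, h6, h7]
  module

theorem prod_aux' {k A : Type*} [Field k] [Ring A] [Algebra k A] {o x y z w v : A}
    (ho : o = 1) (h1 : z * x = w) (h2 : z * y = w) (h3 : z * w = w) (h4 : v * x = w)
    (h5 : v * y = w) (h6 : v * w = w) (h7 : w * x = w) (h8 : w * y = w) (h9 : w * w = w) :
    (o - (2 : k) • (z + v - (2 : k) • w)) * (o - (2 : k) • (x + y - (2 : k) • w)) =
      o - (2 : k) • x - (2 : k) • y - (2 : k) • z - (2 : k) • v + (8 : k) • w := by
  subst ho
  simp only [mul_sub, sub_mul, mul_add, add_mul, smul_mul_assoc, mul_smul_comm, one_mul, mul_one,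
    h1, h2, h3, h4, h5, h6, h7, h8, h9]
  module

/-- The quasi-Hopf algebra `H(2)`: the group algebra `k[C₂]` with its usual comultiplication and
counit, the reassociator `Φ₂`, antipode the identity, `α = g` and `β = 1`. -/
def H2 : QuasiHopfAlgebra k (KC2 k) where
  comul := Bialgebra.comulAlgHom k (KC2 k)
  counit := Bialgebra.counitAlgHom k (KC2 k)
  reassoc := ⟨Phi2 k, Phi2 k, Phi2_mul k, Phi2_mul k⟩
  quasi_coassoc h := by
    exact (Coalgebra.coassoc_apply (R := k) h).symm.trans (units_conj _ _).symm
  counit_right h := by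
    exact congrArg (TensorProduct.rid k _) (Coalgebra.lTensor_counit_comul (R := k) h) |>.trans
      (by simp)
  counit_left h := by
    exact congrArg (TensorProduct.lid k _) (Coalgebra.rTensor_counit_comul (R := k) h) |>.trans
      (by simp)
  cocycle := by
    simp only [Phi2, Algebra.TensorProduct.one_def, map_sub, map_smul, TensorProduct.map_tmul,
      LinearMap.comp_apply, LinearMap.id_apply, LinearEquiv.coe_coe, TensorProduct.assoc_tmul,
      TensorProduct.sub_tmul, TensorProduct.tmul_sub, TensorProduct.tmul_smul,
      AlgHom.toLinearMap_apply, map_one, map_add, Bialgebra.comulAlgHom_apply, comul_pMinus,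
      TensorProduct.add_tmul, TensorProduct.tmul_add, ← TensorProduct.smul_tmul']
    refine (prod_aux (k := k) (w := pMinus k ⊗ₜ[k] (pMinus k ⊗ₜ[k] (pMinus k ⊗ₜ[k] pMinus k)))
      rfl ?_ ?_ ?_ ?_ ?_ ?_ ?_).trans ?_
    case refine_8 =>
      refine (prod_aux' (k := k) rfl ?_ ?_ ?_ ?_ ?_ ?_ ?_ ?_ ?_).symm
      all_goals simp only [Algebra.TensorProduct.tmul_mul_tmul, pMinus_mul, one_mul, mul_one]
    all_goals simp only [Algebra.TensorProduct.tmul_mul_tmul, pMinus_mul, one_mul, mul_one]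
  cocycle_normalized := by
    simp only [Phi2, Algebra.TensorProduct.one_def, map_sub, map_smul, TensorProduct.map_tmul,
      LinearMap.comp_apply, LinearMap.id_apply, LinearEquiv.coe_coe,
      AlgHom.toLinearMap_apply, map_one, Bialgebra.counitAlgHom_apply, counit_pMinus]
    simp
  antipode := LinearMap.id
  antipode_one := rfl
  antipode_mul a b := mul_comm a b
  α := g k
  β := 1
  antipode_left h := by
    refine LinearMap.congr_fun (f := LinearMap.mul' k (KC2 k) ∘ₗ
      (TensorProduct.map (LinearMap.mulRight k (g k) ∘ₗ LinearMap.id) LinearMap.id) ∘ₗ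
      (Bialgebra.comulAlgHom k (KC2 k)).toLinearMap)
      (g := (LinearMap.toSpanSingleton k _ (g k)) ∘ₗ
        (Bialgebra.counitAlgHom k (KC2 k)).toLinearMap) (KC2.hom_ext k ?_ ?_) h
    · simp [Algebra.TensorProduct.one_def]
    · simp [comul_g, counit_g, g_mul_g]
  antipode_right h := by
    refine LinearMap.congr_fun (f := LinearMap.mul' k (KC2 k) ∘ₗ
      (TensorProduct.map (LinearMap.mulRight k 1) LinearMap.id) ∘ₗ
      (Bialgebra.comulAlgHom k (KC2 k)).toLinearMap)
      (g := (LinearMap.toSpanSingleton k _ 1) ∘ₗ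
        (Bialgebra.counitAlgHom k (KC2 k)).toLinearMap) (KC2.hom_ext k ?_ ?_) h
    · simp [Algebra.TensorProduct.one_def]
    · simp [comul_g, counit_g, g_mul_g]
  antipode_reassoc := by
    simp only [Phi2, Algebra.TensorProduct.one_def, map_sub, map_smul, TensorProduct.map_tmul,
      LinearMap.comp_apply, LinearMap.id_apply, LinearMap.mul'_apply, LinearMap.mulRight_apply,
      one_mul, mul_one, mul_right_comm _ (g k), pMinus_mul]
    simp only [g_eq, mul_sub, mul_one, mul_smul_comm, pMinus_mul]
    module
  antipode_reassoc_inv := by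
    change LinearMap.mul' k _ (TensorProduct.map _ _ (Phi2 k)) = 1
    simp only [Phi2, Algebra.TensorProduct.one_def, map_sub, map_smul, TensorProduct.map_tmul,
      LinearMap.comp_apply, LinearMap.id_apply, LinearMap.mul'_apply, LinearMap.mulRight_apply,
      one_mul, mul_one, mul_right_comm _ (g k), pMinus_mul]
    simp only [g_eq, mul_sub, mul_one, mul_smul_comm, pMinus_mul]
    module

/-! ### Yetter-Drinfeld Hopf algebras over `H(2)` with trivial action -/

/-- The trivial action `h · c = ε(h) c` of `H(2)`. -/
def trivAct (C : Type*) [AddCommGroup C] [Module k C] : KC2 k →ₐ[k] Module.End k C :=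
  (Algebra.ofId k (Module.End k C)).comp (H2 k).counit

section Trivial

variable {k}

theorem trivAct_apply {C : Type*} [AddCommGroup C] [Module k C] (h : KC2 k) (c : C) :
    trivAct k C h c = (H2 k).counit h • c := rfl

theorem trivAct_pMinus (C : Type*) [AddCommGroup C] [Module k C] :
    trivAct k C (pMinus k) = 0 := by
  ext c
  rw [trivAct_apply]
  exact (congrArg (· • c) (counit_pMinus k)).trans (zero_smul k c)

variable {M N P : Type*} [AddCommGroup M] [Module k M]
  [AddCommGroup N] [Module k N] [AddCommGroup P] [Module k P]
  (ρ : KC2 k →ₐ[k] Module.End k M) (σ : KC2 k →ₐ[k] Module.End k N)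
  (τ : KC2 k →ₐ[k] Module.End k P)

theorem pairAct_Phi2 (h : ρ (pMinus k) = 0 ∨ σ (pMinus k) = 0 ∨ τ (pMinus k) = 0) :
    pairAct ρ (pairAct σ τ) (Phi2 k) = 1 := by
  have : pairAct ρ (pairAct σ τ) (pMinus k ⊗ₜ[k] (pMinus k ⊗ₜ[k] pMinus k)) = 0 := by
    refine TensorProduct.ext_threefold' (P₂ := M ⊗[k] (N ⊗[k] P)) (h := 0) fun m n p => ?_
    rw [pairAct_tmul, pairAct_tmul]
    rcases h with h | h | h <;> simp [h]
  rw [Phi2, map_sub, map_one, map_smul, this]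
  simp

theorem associator_eq (h : ρ (pMinus k) = 0 ∨ σ (pMinus k) = 0 ∨ τ (pMinus k) = 0) :
    (H2 k).associator ρ σ τ = (TensorProduct.assoc k M N P).toLinearMap := by
  rw [QuasiBialgebra.associator]
  exact congrArg (· ∘ₗ (TensorProduct.assoc k M N P).toLinearMap) (pairAct_Phi2 ρ σ τ h)

theorem associatorInv_eq (h : ρ (pMinus k) = 0 ∨ σ (pMinus k) = 0 ∨ τ (pMinus k) = 0) :
    (H2 k).associatorInv ρ σ τ = (TensorProduct.assoc k M N P).symm.toLinearMap := by
  rw [QuasiBialgebra.associatorInv]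
  exact congrArg ((TensorProduct.assoc k M N P).symm.toLinearMap ∘ₗ ·) (pairAct_Phi2 ρ σ τ h)

theorem pPlus_add_pMinus : pPlus k + pMinus k = 1 := by
  rw [pPlus, pMinus, ← smul_add, add_add_sub_cancel, ← two_smul k (1 : KC2 k), smul_smul,
    inv_mul_cancel₀ two_ne_zero, one_smul]

theorem pPlus_eq : pPlus k = 1 - pMinus k := by rw [← pPlus_add_pMinus, add_sub_cancel_right]

theorem pMinus_mul_pPlus : pMinus k * pPlus k = 0 := by
  rw [pPlus_eq, mul_sub, mul_one, pMinus_mul, sub_self]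

theorem pPlus_mul_pMinus : pPlus k * pMinus k = 0 := by
  rw [mul_comm, pMinus_mul_pPlus]

theorem pPlus_mul : pPlus k * pPlus k = pPlus k := by
  nth_rw 1 [pPlus_eq]
  rw [sub_mul, one_mul, pMinus_mul_pPlus, sub_zero]

theorem H2_counit_pMinus : (H2 k).counit (pMinus k) = 0 := counit_pMinus k

theorem H2_counit_pPlus : (H2 k).counit (pPlus k) = 1 := by
  rw [pPlus_eq, map_sub, map_one, H2_counit_pMinus, sub_zero]

theorem H2_comul_pMinus : (H2 k).comul (pMinus k) =
    pPlus k ⊗ₜ[k] pMinus k + pMinus k ⊗ₜ[k] pPlus k := by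
  refine (comul_pMinus k).trans ?_
  rw [pPlus_eq, TensorProduct.sub_tmul, TensorProduct.tmul_sub]
  module

theorem H2_comul_pPlus : (H2 k).comul (pPlus k) =
    pPlus k ⊗ₜ[k] pPlus k + pMinus k ⊗ₜ[k] pMinus k := by
  rw [pPlus_eq, map_sub, map_one, H2_comul_pMinus, pPlus_eq, Algebra.TensorProduct.one_def]
  simp only [TensorProduct.sub_tmul, TensorProduct.tmul_sub]
  module

variable {C : Type*} [CommRing C] [HopfAlgebra k C] {lam : C →ₗ[k] KC2 k ⊗[k] C}
  {t : C →ₐc[k] C}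

theorem tensorCoact_triv (hlam : ∀ c, lam c = pPlus k ⊗ₜ c + pMinus k ⊗ₜ t c) (m n : C) :
    (H2 k).tensorCoact (trivAct k C) lam (trivAct k C) lam (m ⊗ₜ n) =
      pPlus k ⊗ₜ (m ⊗ₜ n) + pMinus k ⊗ₜ (t m ⊗ₜ t n) := by
  have h0 := trivAct_pMinus (k := k) C
  rw [QuasiBialgebra.tensorCoact, associator_eq _ _ _ (Or.inl h0), associatorInv_eq _ _ _ (Or.inl h0),
    associator_eq _ _ _ (Or.inr (Or.inl h0))]
  simp only [LinearMap.comp_apply, LinearMap.flip_apply, TensorProduct.mk_apply,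
    LinearEquiv.coe_coe, TensorProduct.assoc_tmul, TensorProduct.map_tmul,
    braid_of_sum lam _ (hlam _), TensorProduct.tmul_add, map_add, TensorProduct.assoc_symm_tmul,
    LinearMap.id_apply, regAct_apply, mul_one,
    pPlus_mul, pMinus_mul, pPlus_mul_pMinus, pMinus_mul_pPlus, TensorProduct.zero_tmul,
    add_zero, zero_add]

theorem interchange_triv (hlam : ∀ c, lam c = pPlus k ⊗ₜ c + pMinus k ⊗ₜ t c) (a b a' b' : C) :
    (H2 k).interchange (trivAct k C) lam ((a ⊗ₜ b) ⊗ₜ (a' ⊗ₜ b')) =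
      (a ⊗ₜ a') ⊗ₜ (b ⊗ₜ b') := by
  have h0 := trivAct_pMinus (k := k) C
  rw [QuasiBialgebra.interchange, associator_eq _ _ _ (Or.inl h0),
    associatorInv_eq _ _ _ (Or.inl h0), associatorInv_eq _ _ _ (Or.inl h0),
    associator_eq _ _ _ (Or.inl h0)]
  simp only [LinearMap.comp_apply,
    LinearEquiv.coe_coe, TensorProduct.assoc_tmul, TensorProduct.map_tmul,
    braid_of_sum lam _ (hlam _), TensorProduct.assoc_symm_tmul,
    LinearMap.id_apply, trivAct_apply, H2_counit_pPlus, H2_counit_pMinus,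
    one_smul, zero_smul, TensorProduct.zero_tmul, add_zero]

theorem tensorAct_triv (h : KC2 k) (x : C ⊗[k] C) :
    (H2 k).tensorAct (trivAct k C) (trivAct k C) h x = (H2 k).counit h • x := by
  refine LinearMap.congr_fun (f := (H2 k).tensorAct (trivAct k C) (trivAct k C) h)
    (g := (H2 k).counit h • LinearMap.id) ?_ x
  refine LinearMap.congr_fun (f := ((H2 k).tensorAct (trivAct k C) (trivAct k C)).toLinearMap)
    (g := LinearMap.toSpanSingleton k (Module.End k (C ⊗[k] C)) LinearMap.id ∘ₗ
      (H2 k).counit.toLinearMap) (KC2.hom_ext k ?_ ?_) h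
  · simp [Module.End.one_eq_id]
  · have h1 : (H2 k).comul (g k) = g k ⊗ₜ g k := comul_g k
    have h2 : (H2 k).counit (g k) = 1 := counit_g k
    refine TensorProduct.ext' fun a b => ?_
    simp only [AlgHom.toLinearMap_apply, QuasiBialgebra.tensorAct, AlgHom.comp_apply, h1,
      pairAct_tmul, trivAct_apply, h2, one_smul, LinearMap.comp_apply,
      LinearMap.toSpanSingleton_apply, LinearMap.id_apply]

theorem mul_eq_interchange (hlam : ∀ c, lam c = pPlus k ⊗ₜ c + pMinus k ⊗ₜ t c)
    (x y : C ⊗[k] C) :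
    TensorProduct.map (LinearMap.mul' k C) (LinearMap.mul' k C)
      ((H2 k).interchange (trivAct k C) lam (x ⊗ₜ y)) = x * y := by
  induction x with
  | zero => simp
  | add x x' hx hx' => rw [TensorProduct.add_tmul, map_add, map_add, hx, hx', add_mul]
  | tmul a b =>
    induction y with
    | zero => simp
    | add y y' hy hy' => rw [TensorProduct.tmul_add, map_add, map_add, hy, hy', mul_add]
    | tmul a' b' =>
      rw [interchange_triv hlam]
      simp

theorem map_comul_apply (c : C) :
    Coalgebra.comul (R := k) (t c) =
      TensorProduct.map (t : C →ₗ[k] C) (t : C →ₗ[k] C) (Coalgebra.comul (R := k) c) :=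
  (CoalgHomClass.map_comp_comul_apply t c).symm

variable (lam t) in
/-- An ordinary commutative Hopf algebra `C` with an involution `t` is a Hopf algebra in the
category of Yetter-Drinfeld modules over `H(2)`, for the trivial action and the coaction
`c ↦ p₊ ⊗ c + p₋ ⊗ t(c)`. -/
def trivialActionYD (hlam : ∀ c, lam c = pPlus k ⊗ₜ c + pMinus k ⊗ₜ t c) (ht : ∀ c, t (t c) = c)
    (hS : ∀ c, t (HopfAlgebra.antipode k c) = HopfAlgebra.antipode k (t c)) :
    YDHopfAlgebra (H2 k).toQuasiBialgebra C where
  act := trivAct k C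
  coact := lam
  coact_counit m := by
    simp [hlam, H2_counit_pMinus, H2_counit_pPlus]
  coact_coassoc m := by
    have h0 := trivAct_pMinus (k := k) C
    rw [associator_eq _ _ _ (Or.inl h0), associator_eq _ _ _ (Or.inr (Or.inl h0)),
      associator_eq _ _ _ (Or.inr (Or.inr h0))]
    simp only [LinearEquiv.coe_coe, TensorProduct.assoc_tmul, braid_of_sum lam _ (hlam _)]
    simp only [hlam, QuasiBialgebra.tensorAct, AlgHom.comp_apply, H2_comul_pMinus,
      H2_comul_pPlus, map_add, LinearMap.add_apply, pairAct_tmul, TensorProduct.add_tmul,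
      TensorProduct.map_tmul, TensorProduct.assoc_tmul, braid_of_sum lam _ (hlam _), ht,
      TensorProduct.tmul_add, regAct_apply, mul_one, LinearMap.id_apply]
    abel
  act_coact h m := by
    have h1 : (H2 k).comul (g k) = g k ⊗ₜ g k := comul_g k
    have h2 : (H2 k).counit (g k) = 1 := counit_g k
    refine LinearMap.congr_fun
      (f := LinearMap.applyₗ (R := k) (M₂ := KC2 k ⊗[k] C) (lam m) ∘ₗ
        ((H2 k).tensorAct (regAct k (KC2 k)) (trivAct k C)).toLinearMap)
      (g := braid lam (regAct k (KC2 k)) ∘ₗ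
        LinearMap.applyₗ (R := k) (M₂ := C ⊗[k] KC2 k) (m ⊗ₜ[k] (1 : KC2 k)) ∘ₗ
        ((H2 k).tensorAct (trivAct k C) (regAct k (KC2 k))).toLinearMap)
      (KC2.hom_ext k ?_ ?_) h
    · simp only [LinearMap.comp_apply, LinearMap.applyₗ_apply_apply, AlgHom.toLinearMap_apply,
        map_one, Module.End.one_apply, braid_of_sum lam _ (hlam _), regAct_apply, mul_one, hlam]
    · simp only [LinearMap.comp_apply, LinearMap.applyₗ_apply_apply, AlgHom.toLinearMap_apply,
        QuasiBialgebra.tensorAct, AlgHom.comp_apply, h1, pairAct_tmul, trivAct_apply, h2,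
        one_smul, one_mul, braid_of_sum lam _ (hlam _), regAct_apply, hlam, map_add,
        LinearMap.add_apply, mul_comm (g k)]
  mul := LinearMap.mul' k C
  one := 1
  comul := Coalgebra.comul
  counit := Coalgebra.counit
  one_mul b := by simp
  mul_one b := by simp
  act_mul h x := by rw [tensorAct_triv, trivAct_apply, map_smul]
  act_one h := rfl
  mul_assoc x := by
    rw [associator_eq _ _ _ (Or.inl (trivAct_pMinus C))]
    refine LinearMap.congr_fun (f := LinearMap.mul' k C ∘ₗ
      TensorProduct.map (LinearMap.mul' k C) LinearMap.id) (g := LinearMap.mul' k C ∘ₗ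
      TensorProduct.map LinearMap.id (LinearMap.mul' k C) ∘ₗ
      (TensorProduct.assoc k C C C).toLinearMap) (TensorProduct.ext_threefold fun a b c => ?_) x
    simp [mul_assoc]
  coact_one := by
    rw [hlam, map_one, ← TensorProduct.add_tmul, pPlus_add_pMinus]
  coact_mul x := by
    induction x with
    | zero => simp
    | add x y hx hy => simp only [map_add, hx, hy]
    | tmul a b => rw [tensorCoact_triv hlam]; simp [hlam]
  counit_left b := by
    exact congrArg (TensorProduct.lid k _) (Coalgebra.rTensor_counit_comul (R := k) b) |>.trans
      (by simp)
  counit_right b := by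
    exact congrArg (TensorProduct.rid k _) (Coalgebra.lTensor_counit_comul (R := k) b) |>.trans
      (by simp)
  comul_act h b := by rw [tensorAct_triv, trivAct_apply, map_smul]
  counit_act h b := by rw [trivAct_apply, map_smul, smul_eq_mul]
  coassoc b := by
    rw [associator_eq _ _ _ (Or.inl (trivAct_pMinus C))]
    exact Coalgebra.coassoc_apply (R := k) b
  coact_comul b := by
    have key : ∀ x : C ⊗[k] C, (H2 k).tensorCoact (trivAct k C) lam (trivAct k C) lam x =
        pPlus k ⊗ₜ x + pMinus k ⊗ₜ
          TensorProduct.map (t : C →ₗ[k] C) (t : C →ₗ[k] C) x := by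
      intro x
      induction x with
      | zero => simp
      | add x y hx hy => simp only [map_add, hx, hy, TensorProduct.tmul_add]; abel
      | tmul a b => rw [tensorCoact_triv hlam]; rfl
    rw [key, hlam, map_add, TensorProduct.map_tmul, TensorProduct.map_tmul, map_comul_apply]
    rfl
  coact_counit' b := by
    have : Coalgebra.counit (R := k) (t b) = Coalgebra.counit (R := k) b :=
      CoalgHomClass.counit_comp_apply t b
    rw [hlam, map_add, TensorProduct.map_tmul, TensorProduct.map_tmul, this, map_add,
      TensorProduct.rid_tmul, TensorProduct.rid_tmul, ← smul_add]
    simp only [LinearMap.id_apply, pPlus_add_pMinus]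
  comul_one := by simp [Algebra.TensorProduct.one_def]
  counit_one := by simp
  counit_mul b b' := by simp
  comul_mul b b' := by
    rw [mul_eq_interchange hlam, LinearMap.mul'_apply, Bialgebra.comul_mul]
  exists_antipode := by
    refine ⟨HopfAlgebra.antipode k, fun h b => ?_, fun b => ?_, fun b => ?_, fun b => ?_⟩
    · rw [trivAct_apply, trivAct_apply, map_smul]
    · rw [hlam, hlam, hS, map_add, TensorProduct.map_tmul, TensorProduct.map_tmul]
      rfl
    · rw [Algebra.smul_def, mul_one]
      exact HopfAlgebra.mul_antipode_rTensor_comul_apply b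
    · rw [Algebra.smul_def, mul_one]
      exact HopfAlgebra.mul_antipode_lTensor_comul_apply b

end Trivial

/-- The group Hopf algebra `k[C₃]`. -/
def KC3 (k : Type u) [Field k] : Type u := MonoidAlgebra k (Multiplicative (ZMod 3))

instance (k : Type u) [Field k] : CommRing (KC3 k) :=
  inferInstanceAs (CommRing (MonoidAlgebra k (Multiplicative (ZMod 3))))

instance (k : Type u) [Field k] : HopfAlgebra k (KC3 k) :=
  inferInstanceAs (HopfAlgebra k (MonoidAlgebra k (Multiplicative (ZMod 3))))

/-- The bialgebra endomorphism of `k[C₃]` determined by `x ↦ x²` for `x` in `C₃`. -/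
def squareHom (k : Type u) [Field k] : KC3 k →ₐc[k] KC3 k :=
  MonoidAlgebra.mapDomainBialgHom k (powMonoidHom 2 : Multiplicative (ZMod 3) →* _)

theorem KC3.hom_ext {k : Type u} [Field k] {M : Type*} [AddCommGroup M] [Module k M]
    {f f' : KC3 k →ₗ[k] M}
    (h : ∀ x : Multiplicative (ZMod 3),
      f (MonoidAlgebra.single x 1 : MonoidAlgebra k (Multiplicative (ZMod 3))) =
        f' (MonoidAlgebra.single x 1 : MonoidAlgebra k (Multiplicative (ZMod 3)))) : f = f' :=
  MonoidAlgebra.lhom_ext' (S := k) (R := k) (M := Multiplicative (ZMod 3)) fun x =>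
    LinearMap.ext_ring (h x)

theorem squareHom_single (k : Type u) [Field k] (x : Multiplicative (ZMod 3)) :
    squareHom k (MonoidAlgebra.single x 1 : MonoidAlgebra k (Multiplicative (ZMod 3))) =
      (MonoidAlgebra.single (x ^ 2) 1 : MonoidAlgebra k (Multiplicative (ZMod 3))) :=
  MonoidAlgebra.mapDomain_single

theorem antipode_single (k : Type u) [Field k] (x : Multiplicative (ZMod 3)) :
    HopfAlgebra.antipode (A := KC3 k) k
      (MonoidAlgebra.single x 1 : MonoidAlgebra k (Multiplicative (ZMod 3))) =
      (MonoidAlgebra.single x⁻¹ 1 : MonoidAlgebra k (Multiplicative (ZMod 3))) :=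
  (MonoidAlgebra.antipode_single ..).trans (by simp)

/-- `B_{C₆}`: the group Hopf algebra `k[C₃]` with trivial action and trivial coaction
`b ↦ 1 ⊗ b`. -/
def BC6 : YDHopfAlgebra (H2 k).toQuasiBialgebra (KC3 k) :=
  trivialActionYD (TensorProduct.mk k (KC2 k) (KC3 k) 1) (BialgHom.id k (KC3 k))
    (fun c => by
      rw [BialgHom.id_apply, ← TensorProduct.add_tmul, pPlus_add_pMinus]; rfl)
    (fun _ => rfl) (fun _ => rfl)

/-- `B_*`: the group Hopf algebra `k[C₃]` with trivial action and the coaction determined by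
`x ↦ p₊ ⊗ x + p₋ ⊗ x²` for `x` in `C₃`. -/
def BStar : YDHopfAlgebra (H2 k).toQuasiBialgebra (KC3 k) :=
  trivialActionYD
    (TensorProduct.mk k (KC2 k) (KC3 k) (pPlus k) +
      TensorProduct.mk k (KC2 k) (KC3 k) (pMinus k) ∘ₗ (squareHom k : KC3 k →ₗ[k] KC3 k))
    (squareHom k) (fun _ => rfl)
    (fun c => by
      refine LinearMap.congr_fun (f := (squareHom k : KC3 k →ₗ[k] KC3 k) ∘ₗ
        (squareHom k : KC3 k →ₗ[k] KC3 k)) (g := LinearMap.id) (KC3.hom_ext fun x => ?_) c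
      have hx : (x ^ 2) ^ 2 = x := by revert x; decide
      exact ((congrArg (squareHom k) (squareHom_single k x)).trans
        (squareHom_single k (x ^ 2))).trans (by rw [hx]; rfl))
    (fun c => by
      refine LinearMap.congr_fun (f := (squareHom k : KC3 k →ₗ[k] KC3 k) ∘ₗ
        HopfAlgebra.antipode k) (g := HopfAlgebra.antipode k ∘ₗ
        (squareHom k : KC3 k →ₗ[k] KC3 k)) (KC3.hom_ext fun x => ?_) c
      have hx : (x⁻¹) ^ 2 = (x ^ 2)⁻¹ := by revert x; decide
      refine ((congrArg (squareHom k) (antipode_single k x)).trans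
        (squareHom_single k x⁻¹)).trans ?_
      rw [hx]
      exact ((congrArg (HopfAlgebra.antipode k) (squareHom_single k x)).trans
        (antipode_single k (x ^ 2))).symm)

end HTwo

end QuasiHopf

end

noncomputable section

namespace QuasiHopf

universe u w

/-! ### Hopf algebras of dimension three -/

/-! ### Linear algebra in dimensions two and three. -/

section DimThree

open Module

/-! The algebra `H(2)` is spanned by the orthogonal idempotents `p₊`, `p₋`. Hence a Yetter–Drinfeld
module is a space with an even part and an odd part (where `p₋` acts by `0` and by `1`), and its
coaction is `m ↦ p₊ ⊗ m + p₋ ⊗ t(m)` for a parity-preserving map `t`. The reassociator is a sign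
seen only by three odd factors. Therefore `t² = 1` on even elements but `t² = -1` on odd ones
(`twist_twist_of_even`, `twist_twist_of_odd`).

The main point is that in dimension three the odd part vanishes (`odd_eq_zero`). If the even part is
`k1`, an odd `x` is primitive with `x² = 0`, and `Δ(x²) = 0` forces `t(x) = -x`, against `t² = -1`.
Otherwise a nonzero odd `x` completes to a basis `1, y, x` with `y` even and `ε(y) = 0`. Parity and
the counit leave few structure constants, and `t(x) = qx` with `q² = -1`. Associativity,
coassociativity, multiplicativity of `Δ` and the antipode force `q ∈ {0, 1, -1}`, which is absurd
(`structure_constants_false`).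

Once there are no odd elements, the action is trivial, the reassociator acts as the identity and the
braiding is the flip, so `B` is an ordinary Hopf algebra of dimension three. It is `k[C₃]` by an
elementary argument: the dual algebra acts on `B / k1` through a proper subalgebra of the `2 × 2`
matrices, a common eigenvector yields a nonzero skew-primitive element (`exists_skewPrimitive`), the
absence of primitive elements yields a group-like `u ≠ 1`, and `u² ≠ 1` is checked by hand
(`exists_isGroupLikeElem_order_three`). The map `t` is then a bialgebra involution of `k[C₃]`, so it
fixes or squares `u`; the two possibilities are `B_{C₆}` and `B_*`. -/

/-- This is Burnside's theorem in dimension two: a simple module would give `A = ⊤` by Schur's lemma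
and Jacobson density, so there is a proper nonzero invariant subspace, which is necessarily a line
of common eigenvectors. -/
theorem exists_common_eigenvector {k V : Type*} [Field k] [IsAlgClosed k] [AddCommGroup V]
    [Module k V] (hV : finrank k V = 2) (A : Subalgebra k (Module.End k V)) (hA : A ≠ ⊤) :
    ∃ v : V, v ≠ 0 ∧ ∀ a ∈ A, ∃ c : k, a v = c • v := by
  classical
  have hfin : FiniteDimensional k V := FiniteDimensional.of_finrank_pos (by omega)
  have hnt : Nontrivial V := Module.nontrivial_of_finrank_pos (R := k) (by omega)
  by_cases hs : IsSimpleModule A V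
  · refine absurd (eq_top_iff.2 fun f _ => ?_) hA
    have hsc : ∀ e : Module.End A V, ∃ c : k, ∀ x, e x = c • x := fun e => by
      obtain ⟨c, rfl⟩ := (IsSimpleModule.algebraMap_end_bijective_of_isAlgClosed (A := A)
        (V := V) k).2 e
      exact ⟨c, fun x => rfl⟩
    -- The endomorphisms commuting with `A` are scalars, so every `k`-linear map commutes with them
    -- and density applies to it.
    let f' : Module.End (Module.End A V) V :=
      { toFun := f
        map_add' := map_add f
        map_smul' := fun e x => by
          obtain ⟨c, hc⟩ := hsc e
          change f (e x) = e (f x)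
          rw [hc, hc, map_smul] }
    obtain ⟨b⟩ : Nonempty (Basis (Fin 2) k V) := ⟨finBasisOfFinrankEq k V hV⟩
    obtain ⟨r, hr⟩ := jacobson_density (R := A) f' (Finset.univ.image b)
    have : f = r.1 := b.ext fun i => hr (b i) (by simp)
    rw [this]
    exact r.2
  · obtain ⟨N, hN0, hN1⟩ : ∃ N : Submodule A V, N ≠ ⊥ ∧ N ≠ ⊤ := by
      by_contra! h
      refine hs ((isSimpleModule_iff A V).2 ?_)
      exact { exists_pair_ne := ⟨⊥, ⊤, bot_ne_top⟩
              eq_bot_or_eq_top := fun N => or_iff_not_imp_left.2 (h N) }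
    obtain ⟨v, hvN, hv⟩ := Submodule.exists_mem_ne_zero_of_ne_bot hN0
    refine ⟨v, hv, fun a ha => ?_⟩
    have hav : a v ∈ N := N.smul_mem (⟨a, ha⟩ : A) hvN
    by_contra! hc
    refine hN1 (eq_top_iff.2 fun x _ => ?_)
    -- If `a v` were not a multiple of `v`, the two vectors would span `V` inside `N`.
    have hli : LinearIndependent k ![v, a v] := by
      refine (LinearIndependent.pair_iff' hv).2 fun c => (hc c).symm
    have hspan := hli.span_eq_top_of_card_eq_finrank (by simp [hV])
    have hx : x ∈ Submodule.span k (Set.range ![v, a v]) := hspan ▸ Submodule.mem_top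
    have hle : Submodule.span k (Set.range ![v, a v]) ≤ N.restrictScalars k := by
      rw [Submodule.span_le]
      rintro _ ⟨i, rfl⟩
      fin_cases i
      · exact hvN
      · exact hav
    exact hle hx

/-- Three independent vectors in a three-dimensional space have a dual family of functionals. -/
theorem exists_dual_of_three {k B : Type*} [Field k] [AddCommGroup B] [Module k B]
    {x y z : B} (h : LinearIndependent k ![x, y, z]) :
    ∃ f₁ f₂ f₃ : B →ₗ[k] k, (f₁ x = 1 ∧ f₁ y = 0 ∧ f₁ z = 0) ∧ (f₂ x = 0 ∧ f₂ y = 1 ∧ f₂ z = 0) ∧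
      (f₃ x = 0 ∧ f₃ y = 0 ∧ f₃ z = 1) := by
  have key : ∀ c : Fin 3 → k, ∃ f : B →ₗ[k] k, f x = c 0 ∧ f y = c 1 ∧ f z = c 2 := by
    intro c
    let g := (Basis.span h).constr k c
    obtain ⟨f, hf⟩ := LinearMap.exists_extend g
    have hi : ∀ i, f (![x, y, z] i) = c i := fun i => by
      have h1 : f (Basis.span h i : B) = g (Basis.span h i) := LinearMap.congr_fun hf _
      have h2 : (Basis.span h i : B) = ![x, y, z] i := congrArg Subtype.val (Basis.span_apply h i)
      rw [← h2, h1]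
      exact (Basis.span h).constr_basis k c i
    exact ⟨f, hi 0, hi 1, hi 2⟩
  obtain ⟨f₁, h₁⟩ := key ![1, 0, 0]
  obtain ⟨f₂, h₂⟩ := key ![0, 1, 0]
  obtain ⟨f₃, h₃⟩ := key ![0, 0, 1]
  exact ⟨f₁, f₂, f₃, by simpa using h₁, by simpa using h₂, by simpa using h₃⟩

theorem exists_coeff_of_three {k B : Type*} [Field k] [AddCommGroup B] [Module k B]
    (hB : finrank k B = 3) {x y z : B} (h : LinearIndependent k ![x, y, z]) (b : B) :
    ∃ r s t : k, b = r • x + s • y + t • z := by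
  have hspan := h.span_eq_top_of_card_eq_finrank (by simp [hB])
  have hb : b ∈ Submodule.span k (Set.range ![x, y, z]) := hspan ▸ Submodule.mem_top
  obtain ⟨c, rfl⟩ := (Submodule.mem_span_range_iff_exists_fun k).1 hb
  exact ⟨c 0, c 1, c 2, by simp [Fin.sum_univ_three]⟩

theorem exists_tmul_of_three {k B M : Type*} [Field k] [AddCommGroup B] [Module k B]
    [AddCommGroup M] [Module k M]
    (hB : finrank k B = 3) {x y z : B} (h : LinearIndependent k ![x, y, z]) (τ : B ⊗[k] M) :
    ∃ r s t : M, τ = x ⊗ₜ r + y ⊗ₜ s + z ⊗ₜ t := by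
  induction τ with
  | zero => exact ⟨0, 0, 0, by simp⟩
  | tmul b c =>
    obtain ⟨r, s, t, rfl⟩ := exists_coeff_of_three hB h b
    exact ⟨r • c, s • c, t • c, by simp [TensorProduct.add_tmul, TensorProduct.smul_tmul']⟩
  | add τ τ' h1 h2 =>
    obtain ⟨r, s, t, rfl⟩ := h1
    obtain ⟨r', s', t', rfl⟩ := h2
    exact ⟨r + r', s + s', t + t', by simp only [TensorProduct.tmul_add]; abel⟩

/-- Contraction of the left tensor factor with a functional. -/
def contractLeft {k B : Type*} [CommRing k] [AddCommGroup B] [Module k B]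
    (M : Type*) [AddCommGroup M] [Module k M] (f : B →ₗ[k] k) : B ⊗[k] M →ₗ[k] M :=
  (TensorProduct.lid k M).toLinearMap ∘ₗ TensorProduct.map f LinearMap.id

@[simp] theorem contractLeft_tmul {k B : Type*} [CommRing k] [AddCommGroup B] [Module k B]
    {M : Type*} [AddCommGroup M] [Module k M] (f : B →ₗ[k] k) (b : B) (m : M) :
    contractLeft M f (b ⊗ₜ m) = f b • m := by
  simp [contractLeft]

theorem tmul_inj_of_three {k B M : Type*} [Field k] [AddCommGroup B] [Module k B]
    [AddCommGroup M] [Module k M]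
    {x y z : B} (h : LinearIndependent k ![x, y, z]) {r s t r' s' t' : M}
    (e : x ⊗ₜ[k] r + y ⊗ₜ s + z ⊗ₜ t = x ⊗ₜ r' + y ⊗ₜ s' + z ⊗ₜ t') :
    r = r' ∧ s = s' ∧ t = t' := by
  obtain ⟨f₁, f₂, f₃, ⟨a1, a2, a3⟩, ⟨b1, b2, b3⟩, c1, c2, c3⟩ := exists_dual_of_three h
  refine ⟨?_, ?_, ?_⟩
  · simpa [a1, a2, a3] using congrArg (contractLeft M f₁) e
  · simpa [b1, b2, b3] using congrArg (contractLeft M f₂) e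
  · simpa [c1, c2, c3] using congrArg (contractLeft M f₃) e

theorem exists_linearIndependent_three {k B : Type*} [Field k] [AddCommGroup B] [Module k B]
    (hB : finrank k B = 3) {x y : B} (h : LinearIndependent k ![x, y]) :
    ∃ z, LinearIndependent k ![x, y, z] := by
  obtain ⟨z, hz⟩ : ∃ z, z ∉ Submodule.span k (Set.range ![x, y]) := by
    by_contra! hall
    have h1 : Submodule.span k (Set.range ![x, y]) = ⊤ := eq_top_iff.2 fun z _ => hall z
    have h2 := finrank_span_eq_card h
    rw [h1, finrank_top, hB] at h2
    simp at h2
  refine ⟨z, ?_⟩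
  have h3 : LinearIndependent k (Fin.snoc ![x, y] z : Fin 3 → B) :=
    linearIndependent_finSnoc.2 ⟨h, hz⟩
  convert h3 using 1
  ext i
  fin_cases i <;> rfl

end DimThree

/-! ### Ordinary Hopf algebras of dimension three. -/

section HopfThree

open Module

variable {k B : Type*} [Field k] [Ring B] [HopfAlgebra k B]

theorem eq_combination_of_not_linearIndependent {k B : Type*} [Field k] [AddCommGroup B]
    [Module k B] {x y z : B} (h : LinearIndependent k ![x, y])
    (hz : ¬ LinearIndependent k ![x, y, z]) : ∃ a b : k, z = a • x + b • y := by
  by_contra! hall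
  refine hz ?_
  have h3 : LinearIndependent k (Fin.snoc ![x, y] z : Fin 3 → B) := by
    refine linearIndependent_finSnoc.2 ⟨h, fun hm => ?_⟩
    obtain ⟨c, hc⟩ := (Submodule.mem_span_range_iff_exists_fun k).1 hm
    exact hall (c 0) (c 1) (by simp [← hc, Fin.sum_univ_two])
  convert h3 using 1
  ext i
  fin_cases i <;> rfl

theorem counit_tmul_comul (b : B) : contractLeft B (Coalgebra.counit (R := k))
    (Coalgebra.comul (R := k) b) = b := by
  exact (congrArg (TensorProduct.lid k B) (Coalgebra.rTensor_counit_comul (R := k) b)).trans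
    (by simp)

theorem counit_eq_zero_of_skew {p u v : B} (hu : IsGroupLikeElem k u) (hv : IsGroupLikeElem k v)
    (hp : Coalgebra.comul (R := k) p = p ⊗ₜ u + v ⊗ₜ p) : Coalgebra.counit (R := k) p = 0 := by
  have h := counit_tmul_comul (k := k) p
  rw [hp] at h
  simp only [map_add, contractLeft_tmul, hv.counit_eq_one, one_smul, add_eq_right] at h
  exact (smul_eq_zero.1 h).resolve_right fun h0 => by simpa [h0] using hu.counit_eq_one

theorem linearIndependent_one_of_counit {p : B} (hp : p ≠ 0)
    (h0 : Coalgebra.counit (R := k) p = 0) : LinearIndependent k ![(1 : B), p] := by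
  rw [LinearIndependent.pair_iff]
  intro s t h
  have hs : s = 0 := by simpa [h0] using congrArg (Coalgebra.counit (R := k)) h
  subst hs
  rw [zero_smul, zero_add] at h
  exact ⟨rfl, (smul_eq_zero.1 h).resolve_right hp⟩

theorem exists_dual_of_two {x y : B} (hB : finrank k B = 3) (h : LinearIndependent k ![x, y]) :
    ∃ f : B →ₗ[k] k, f x = 0 ∧ f y = 1 := by
  obtain ⟨z, hz⟩ := exists_linearIndependent_three hB h
  obtain ⟨-, f, -, -, h, -⟩ := exists_dual_of_three hz
  exact ⟨f, h.1, h.2.1⟩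

/-- A Hopf algebra of dimension three in characteristic zero has no nonzero primitive element. -/
theorem primitive_eq_zero [CharZero k] (hB : finrank k B = 3) {p : B}
    (hp : Coalgebra.comul (R := k) p = p ⊗ₜ 1 + 1 ⊗ₜ p) : p = 0 := by
  by_contra hne
  have h0 : Coalgebra.counit (R := k) p = 0 := counit_eq_zero_of_skew .one .one hp
  have h2 := linearIndependent_one_of_counit hne h0
  have hpp : Coalgebra.comul (R := k) (p * p) =
      (p * p) ⊗ₜ 1 + (2 : k) • p ⊗ₜ p + 1 ⊗ₜ (p * p) := by
    rw [Bialgebra.comul_mul, hp]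
    simp only [mul_add, add_mul, Algebra.TensorProduct.tmul_mul_tmul, one_mul, mul_one]
    module
  by_cases h3 : LinearIndependent k ![(1 : B), p, p * p]
  · obtain ⟨f₁, f₂, f₃, -, hf₂, hf₃⟩ := exists_dual_of_three h3
    obtain ⟨a, b, c, habc⟩ := exists_coeff_of_three hB h3 (p * p * p)
    -- The coefficient of `p² ⊗ p` is `3` in `Δ(p³)` and `0` in `Δ` of any combination of `1, p,
    -- p²`.
    have h4 := congrArg (fun b => f₂ (contractLeft B f₃ (Coalgebra.comul (R := k) b))) habc
    simp only [Bialgebra.comul_mul (p * p), map_add, map_smul, hpp] at h4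
    simp only [hp, mul_add, add_mul, Algebra.TensorProduct.tmul_mul_tmul, one_mul, mul_one,
      map_add, map_smul, contractLeft_tmul, hf₂, hf₃, Bialgebra.comul_one,
      Algebra.TensorProduct.one_def, smul_eq_mul, smul_mul_assoc] at h4
    norm_num at h4
  · obtain ⟨a, b, hab⟩ := eq_combination_of_not_linearIndependent h2 h3
    obtain ⟨f, hf1, hfp⟩ := exists_dual_of_two hB h2
    -- The coefficient of `p ⊗ p` is `2` in `Δ(p²)` and `0` in `Δ(a1 + bp)`.
    have h4 := congrArg (fun b => f (contractLeft B f (Coalgebra.comul (R := k) b))) hab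
    simp only [hpp, hp, map_add, map_smul, contractLeft_tmul, hf1, hfp, Bialgebra.comul_one,
      Algebra.TensorProduct.one_def, smul_eq_mul] at h4
    norm_num at h4

theorem linearIndependent_of_isGroupLikeElem {u v : B} (hu : IsGroupLikeElem k u)
    (hv : IsGroupLikeElem k v) (h : u ≠ v) : LinearIndependent k ![u, v] := by
  let w : Fin 2 → GroupLike k B := ![⟨u, hu⟩, ⟨v, hv⟩]
  have hw : Function.Injective w := by
    intro i j hij
    have h1 := congrArg GroupLike.val hij
    fin_cases i <;> fin_cases j <;> simp_all [w]
  have e : ![u, v] = GroupLike.val ∘ w := by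
    ext i
    fin_cases i <;> rfl
  rw [e]
  exact linearIndep_groupLikeVal.comp w hw

theorem linearIndependent_of_isGroupLikeElem₃ {u v w : B} (hu : IsGroupLikeElem k u)
    (hv : IsGroupLikeElem k v) (hw : IsGroupLikeElem k w) (h : u ≠ v) (h' : u ≠ w) (h'' : v ≠ w) :
    LinearIndependent k ![u, v, w] := by
  let a : Fin 3 → GroupLike k B := ![⟨u, hu⟩, ⟨v, hv⟩, ⟨w, hw⟩]
  have ha : Function.Injective a := by
    intro i j hij
    have h1 := congrArg GroupLike.val hij
    fin_cases i <;> fin_cases j <;> simp_all [a]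
  have e : ![u, v, w] = GroupLike.val ∘ a := by
    ext i
    fin_cases i <;> rfl
  rw [e]
  exact linearIndep_groupLikeVal.comp a ha

/-- In dimension three there are at most three group-like elements. -/
theorem isGroupLikeElem_mem_of_three (hB : finrank k B = 3) {u v w x : B}
    (hu : IsGroupLikeElem k u)
    (hv : IsGroupLikeElem k v) (hw : IsGroupLikeElem k w) (h : u ≠ v) (h' : u ≠ w) (h'' : v ≠ w)
    (hx : IsGroupLikeElem k x) : x = u ∨ x = v ∨ x = w := by
  by_contra! hne
  have hfin : FiniteDimensional k B := FiniteDimensional.of_finrank_pos (by omega)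
  let a : Fin 4 → GroupLike k B := ![⟨u, hu⟩, ⟨v, hv⟩, ⟨w, hw⟩, ⟨x, hx⟩]
  have ha : Function.Injective a := by
    intro i j hij
    have h1 := congrArg GroupLike.val hij
    obtain ⟨h2, h3, h4⟩ := hne
    fin_cases i <;> fin_cases j <;> simp [a] at h1 ⊢ <;>
      first | exact h h1 | exact h' h1 | exact h'' h1 | exact h h1.symm | exact h' h1.symm |
        exact h'' h1.symm | exact h2 h1 | exact h3 h1 | exact h4 h1 | exact h2 h1.symm |
        exact h3 h1.symm | exact h4 h1.symm
  have := (linearIndep_groupLikeVal.comp a ha).fintype_card_le_finrank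
  simp [hB] at this

theorem mul_left_cancel_of_isGroupLikeElem {u a b : B} (hu : IsGroupLikeElem k u)
    (h : u * a = u * b) : a = b :=
  hu.isUnit.mul_left_cancel h

/-- A `(1, u)`-skew-primitive element is trivial if `u` is group-like of order two. -/
theorem skewPrimitive_eq (hB : finrank k B = 3) {u p : B}
    (hu : IsGroupLikeElem k u) (hu1 : u ≠ 1) (huu : u * u = 1)
    (hp : Coalgebra.comul (R := k) p = p ⊗ₜ u + 1 ⊗ₜ p) : ∃ a b : k, p = a • 1 + b • u := by
  have h2 := linearIndependent_of_isGroupLikeElem (k := k) .one hu hu1.symm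
  by_cases h3 : LinearIndependent k ![1, u, p]
  · obtain ⟨f₁, f₂, f₃, -, hf₂, hf₃⟩ := exists_dual_of_three h3
    obtain ⟨a, b, c, habc⟩ := exists_coeff_of_three hB h3 (u * p)
    -- Since `Δ(up) = up ⊗ 1 + u ⊗ up` has no `p ⊗ u` term, the coefficient `c` is zero; so `up`,
    -- and with it `p = u(up)`, lies in the span of `1, u`.
    have h4 := congrArg (fun b => f₂ (contractLeft B f₃ (Coalgebra.comul (R := k) b))) habc
    simp only [map_add, map_smul] at h4
    simp only [Bialgebra.comul_mul, hp, hu.comul_eq_tmul_self, mul_add,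
      Algebra.TensorProduct.tmul_mul_tmul, mul_one, huu,
      map_add, map_smul, contractLeft_tmul, hf₂, hf₃, Bialgebra.comul_one,
      Algebra.TensorProduct.one_def, smul_eq_mul, mul_zero, zero_mul, add_zero, zero_add] at h4
    refine ⟨b, a, ?_⟩
    calc p = u * (u * p) := by rw [← mul_assoc, huu, one_mul]
      _ = b • 1 + a • u := by
        rw [habc, ← h4, zero_smul, add_zero, mul_add, mul_smul_comm, mul_smul_comm, huu, mul_one,
          add_comm]
  · exact eq_combination_of_not_linearIndependent h2 h3

/-- Contraction of the right tensor factor with a functional. -/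
def contractRight {k N : Type*} [CommRing k] [AddCommGroup N] [Module k N]
    (M : Type*) [AddCommGroup M] [Module k M] (f : N →ₗ[k] k) : M ⊗[k] N →ₗ[k] M :=
  (TensorProduct.rid k M).toLinearMap ∘ₗ TensorProduct.map LinearMap.id f

@[simp] theorem contractRight_tmul {k N : Type*} [CommRing k] [AddCommGroup N] [Module k N]
    {M : Type*} [AddCommGroup M] [Module k M] (f : N →ₗ[k] k) (m : M) (n : N) :
    contractRight M f (m ⊗ₜ n) = f n • m := by
  simp [contractRight]

theorem comul_tmul_counit (b : B) : contractRight B (Coalgebra.counit (R := k))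
    (Coalgebra.comul (R := k) b) = b := by
  exact (congrArg (TensorProduct.rid k B) (Coalgebra.lTensor_counit_comul (R := k) b)).trans
    (by simp)

/-- The operator `b ↦ b₁ f(b₂)`. -/
def hitMap (f : B →ₗ[k] k) : B →ₗ[k] B := contractRight B f ∘ₗ Coalgebra.comul

/-- By coassociativity the composite is the operator of the convolution product `b ↦ g(b₁) f(b₂)`.
This is why these operators form an algebra. -/
theorem hitMap_hitMap (f g : B →ₗ[k] k) (b : B) :
    hitMap g (hitMap f b) = hitMap (f ∘ₗ contractLeft B g ∘ₗ Coalgebra.comul) b := by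
  have h1 : ∀ τ : B ⊗[k] B, hitMap g (contractRight B f τ) =
      contractRight B (f ∘ₗ contractLeft B g) (TensorProduct.assoc k B B B
        (LinearMap.rTensor B Coalgebra.comul τ)) := by
    intro τ
    induction τ with
    | zero => simp
    | add x y hx hy => simp only [map_add, hx, hy]
    | tmul a c =>
      rw [contractRight_tmul, map_smul, hitMap, LinearMap.comp_apply, LinearMap.rTensor_tmul]
      induction Coalgebra.comul (R := k) a with
      | zero => simp
      | add x y hx hy => simp only [map_add, smul_add, hx, hy, TensorProduct.add_tmul]
      | tmul d e => simp [smul_smul, mul_comm]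
  have h2 : ∀ τ : B ⊗[k] B, contractRight B (f ∘ₗ contractLeft B g)
      (LinearMap.lTensor B Coalgebra.comul τ) =
      contractRight B (f ∘ₗ contractLeft B g ∘ₗ Coalgebra.comul) τ := by
    intro τ
    induction τ with
    | zero => simp
    | add x y hx hy => simp only [map_add, hx, hy]
    | tmul a c => simp
  refine (h1 _).trans ?_
  rw [Coalgebra.coassoc_apply, h2]
  rfl

theorem hitMap_one (f : B →ₗ[k] k) : hitMap f 1 = f 1 • (1 : B) := by
  simp [hitMap, Algebra.TensorProduct.one_def]

theorem hitMap_counit (b : B) : hitMap (Coalgebra.counit (R := k)) b = b :=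
  comul_tmul_counit b

theorem coassoc_rTensor (b : B) :
    TensorProduct.assoc k B B B (LinearMap.rTensor B Coalgebra.comul (Coalgebra.comul (R := k) b)) =
      LinearMap.lTensor B Coalgebra.comul (Coalgebra.comul (R := k) b) :=
  Coalgebra.coassoc_apply b

/-- The operators on `B / k1` induced by the operators `b ↦ b₁ f(b₂)`. -/
def hitQuot : (B →ₗ[k] k) →ₗ[k] Module.End k (B ⧸ Submodule.span k {(1 : B)}) where
  toFun f := Submodule.mapQ _ _ (hitMap f) (by
    rw [Submodule.span_le, Set.singleton_subset_iff]
    change hitMap f 1 ∈ Submodule.span k {(1 : B)}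
    rw [hitMap_one]
    exact Submodule.smul_mem _ _ (Submodule.mem_span_singleton_self _))
  map_add' f g := by
    refine Submodule.linearMap_qext _ (LinearMap.ext fun b => ?_)
    have : hitMap (f + g) b = hitMap f b + hitMap g b := by
      simp [hitMap, contractRight, TensorProduct.map_add_right]
    exact congrArg (Submodule.Quotient.mk) this
  map_smul' c f := by
    refine Submodule.linearMap_qext _ (LinearMap.ext fun b => ?_)
    have : hitMap (c • f) b = c • hitMap f b := by
      simp [hitMap, contractRight, TensorProduct.map_smul_right]
    exact congrArg (Submodule.Quotient.mk) this

theorem hitQuot_mk (f : B →ₗ[k] k) (b : B) :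
    hitQuot f (Submodule.Quotient.mk b) = Submodule.Quotient.mk (hitMap f b) := rfl

variable (k B) in
/-- The subalgebra of the operators on `B / k1` induced by the operators `b ↦ b₁ f(b₂)`. -/
def hitAlgebra : Subalgebra k (Module.End k (B ⧸ Submodule.span k {(1 : B)})) :=
  Submodule.toSubalgebra (LinearMap.range hitQuot)
    ⟨Coalgebra.counit, Submodule.linearMap_qext _ (LinearMap.ext fun b =>
      congrArg (Submodule.Quotient.mk) (hitMap_counit b))⟩
    (by
      rintro _ _ ⟨g, rfl⟩ ⟨f, rfl⟩
      exact ⟨f ∘ₗ contractLeft B g ∘ₗ Coalgebra.comul,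
        Submodule.linearMap_qext _ (LinearMap.ext fun b =>
          congrArg (Submodule.Quotient.mk) (hitMap_hitMap f g b).symm)⟩)

theorem finrank_quotient_one (hB : finrank k B = 3) :
    finrank k (B ⧸ Submodule.span k {(1 : B)}) = 2 := by
  have hfin : FiniteDimensional k B := FiniteDimensional.of_finrank_pos (by omega)
  have hnt : Nontrivial B := Module.nontrivial_of_finrank_pos (R := k) (by omega)
  have h1 := Submodule.finrank_quotient_add_finrank (Submodule.span k {(1 : B)})
  rw [finrank_span_singleton one_ne_zero] at h1
  omega

/-- The algebra is an image of the three-dimensional dual of `B`, while the endomorphisms of `B /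
k1` have dimension four. -/
theorem hitAlgebra_ne_top (hB : finrank k B = 3) : hitAlgebra k B ≠ ⊤ := by
  have hfin : FiniteDimensional k B := FiniteDimensional.of_finrank_pos (by omega)
  intro h
  have h1 : LinearMap.range (hitQuot (k := k) (B := B)) = ⊤ :=
    eq_top_iff.2 fun x _ => by
      have : x ∈ hitAlgebra k B := h ▸ Algebra.mem_top
      exact this
  have h2 := LinearMap.finrank_range_le (hitQuot (k := k) (B := B))
  rw [h1, finrank_top, Module.finrank_linearMap, Module.finrank_linearMap,
    finrank_quotient_one hB, hB, finrank_self] at h2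
  omega

/-- A common eigenvector of the dual algebra in `B / k1` lifts to some `w` with `ε(w) = 0` and `Δ(w)
= 1 ⊗ p + w ⊗ u`. The coalgebra axioms then give `p = w` and make `u` group-like. -/
theorem exists_skewPrimitive [IsAlgClosed k] (hB : finrank k B = 3) :
    ∃ p u : B, p ≠ 0 ∧ Coalgebra.counit (R := k) p = 0 ∧ IsGroupLikeElem k u ∧
      Coalgebra.comul (R := k) p = p ⊗ₜ u + 1 ⊗ₜ p := by
  obtain ⟨v, hv, hA⟩ := exists_common_eigenvector (finrank_quotient_one hB) (hitAlgebra k B)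
    (hitAlgebra_ne_top hB)
  obtain ⟨b, rfl⟩ := Submodule.Quotient.mk_surjective _ v
  obtain ⟨w, hw0, hwb⟩ : ∃ w : B, Coalgebra.counit (R := k) w = 0 ∧
      (Submodule.Quotient.mk b : B ⧸ Submodule.span k {(1 : B)}) = Submodule.Quotient.mk w := by
    refine ⟨b - Coalgebra.counit (R := k) b • 1, by simp, ?_⟩
    rw [Submodule.Quotient.eq, sub_sub_cancel]
    exact Submodule.smul_mem _ _ (Submodule.mem_span_singleton_self _)
  rw [hwb] at hv hA
  have hw : w ≠ 0 := by
    rintro rfl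
    exact hv rfl
  have h2 := linearIndependent_one_of_counit hw hw0
  obtain ⟨z, hz⟩ := exists_linearIndependent_three hB h2
  obtain ⟨p, u, r, hpur⟩ := exists_tmul_of_three hB hz (Coalgebra.comul (R := k) w)
  obtain ⟨f₁, f₂, f₃, hf₁, hf₂, hf₃⟩ := exists_dual_of_three hz
  -- For every functional `f` the `z`-coordinate of `w₁ f(w₂)` is `f(r)`, and it vanishes because
  -- `w₁ f(w₂)` is a multiple of `w` modulo `1`.
  have hr : r = 0 := by
    rw [← Module.forall_dual_apply_eq_zero_iff k]
    intro f
    obtain ⟨c, hc⟩ := hA (hitQuot f) ⟨f, rfl⟩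
    rw [hitQuot_mk, ← Submodule.Quotient.mk_smul, Submodule.Quotient.eq,
      Submodule.mem_span_singleton] at hc
    obtain ⟨a, ha⟩ := hc
    have := congrArg f₃ ha
    simpa [hitMap, hpur, hf₃] using this.symm
  subst hr
  rw [TensorProduct.tmul_zero, add_zero] at hpur
  have hco := coassoc_rTensor (k := k) w
  simp only [hpur, map_add, LinearMap.rTensor_tmul, LinearMap.lTensor_tmul, Bialgebra.comul_one,
    Algebra.TensorProduct.one_def, TensorProduct.add_tmul, TensorProduct.assoc_tmul] at hco
  obtain ⟨h3, h4, -⟩ := tmul_inj_of_three hz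
    (r := 1 ⊗ₜ p + p ⊗ₜ u) (s := u ⊗ₜ u) (t := 0) (r' := Coalgebra.comul (R := k) p)
    (s' := Coalgebra.comul (R := k) u) (t' := 0)
    (by rw [← hco]; simp only [TensorProduct.tmul_add, TensorProduct.tmul_zero]; abel)
  have hwp : p = w := by
    have := counit_tmul_comul (k := k) w
    simpa [hpur, hw0] using this
  subst hwp
  have hu1 : Coalgebra.counit (R := k) u = 1 := by
    have := congrArg f₂ (comul_tmul_counit (k := k) p)
    simpa [hpur, hf₂] using this
  exact ⟨p, u, hw, hw0, ⟨hu1, h4.symm⟩, by rw [← h3, add_comm]⟩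

/-- A Hopf algebra of dimension three with a group-like element of order two does not exist. -/
theorem isGroupLikeElem_mul_self_ne_one [CharZero k] (hB : finrank k B = 3) {u : B}
    (hu : IsGroupLikeElem k u) (hu1 : u ≠ 1) : u * u ≠ 1 := by
  intro huu
  have h2 := linearIndependent_of_isGroupLikeElem (k := k) .one hu hu1.symm
  obtain ⟨z, hz⟩ := exists_linearIndependent_three hB h2
  obtain ⟨f₁, f₂, f₃, hf₁, hf₂, hf₃⟩ := exists_dual_of_three hz
  have hno : ∀ a b : k, z ≠ a • 1 + b • u := by
    intro a b h
    simpa [h, hf₃] using hf₃.2.2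
  obtain ⟨p, q, v, hpq⟩ := exists_tmul_of_three hB hz (Coalgebra.comul (R := k) z)
  -- With `Δ(z) = 1 ⊗ p + u ⊗ q + z ⊗ v`, coassociativity makes `v` group-like and `p`, `q`
  -- skew-primitive. The counit gives `z = p + q + ε(z) v`, so it suffices to put `p`, `q`, `v` in
  -- the span of `1, u`.
  have hco := coassoc_rTensor (k := k) z
  simp only [hpq, map_add, LinearMap.rTensor_tmul, LinearMap.lTensor_tmul, Bialgebra.comul_one,
    Algebra.TensorProduct.one_def, TensorProduct.add_tmul, TensorProduct.assoc_tmul,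
    hu.comul_eq_tmul_self] at hco
  obtain ⟨hp, hq, hv⟩ := tmul_inj_of_three hz
    (r := 1 ⊗ₜ p + p ⊗ₜ v) (s := u ⊗ₜ q + q ⊗ₜ v) (t := v ⊗ₜ v)
    (r' := Coalgebra.comul (R := k) p)
    (s' := Coalgebra.comul (R := k) q) (t' := Coalgebra.comul (R := k) v)
    (by rw [← hco]; simp only [TensorProduct.tmul_add]; abel)
  have hv1 : Coalgebra.counit (R := k) v = 1 := by
    have := congrArg f₃ (comul_tmul_counit (k := k) z)
    simpa [hpq, hf₃] using this
  have hvg : IsGroupLikeElem k v := ⟨hv1, hv.symm⟩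
  have hzpq : p + q + Coalgebra.counit (R := k) z • v = z := by
    have := counit_tmul_comul (k := k) z
    simpa [hpq, hu.counit_eq_one] using this
  -- Multiplication by `u` turns `Δ(q) = u ⊗ q + q ⊗ v` into a skew-primitivity relation based at
  -- `1`.
  have huq : Coalgebra.comul (R := k) (u * q) = (u * q) ⊗ₜ (u * v) + 1 ⊗ₜ (u * q) := by
    rw [Bialgebra.comul_mul, ← hq, hu.comul_eq_tmul_self, mul_add,
      Algebra.TensorProduct.tmul_mul_tmul, Algebra.TensorProduct.tmul_mul_tmul, huu, add_comm]
  have hq' : q = u * (u * q) := by rw [← mul_assoc, huu, one_mul]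
  by_cases e1 : v = 1
  · subst e1
    have hp0 : p = 0 := primitive_eq_zero hB (by rw [← hp, add_comm])
    rw [mul_one] at huq
    obtain ⟨a, b, hab⟩ := skewPrimitive_eq hB hu hu1 huu huq
    refine hno (b + Coalgebra.counit (R := k) z) a ?_
    -- The scalar `ε(z)` is named so that rewriting `z` does not also rewrite inside it.
    generalize Coalgebra.counit (R := k) z = c at *
    rw [← hzpq, hp0, hq', hab, mul_add, mul_smul_comm, mul_smul_comm, huu, mul_one]
    module
  by_cases e2 : v = u
  · subst e2
    rw [huu] at huq
    have hq0 : q = 0 := by rw [hq', primitive_eq_zero hB huq, mul_zero]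
    obtain ⟨a, b, hab⟩ := skewPrimitive_eq hB hu hu1 huu (p := p) (by rw [← hp, add_comm])
    refine hno a (b + Coalgebra.counit (R := k) z) ?_
    generalize Coalgebra.counit (R := k) z = c at *
    rw [← hzpq, hab, hq0]
    module
  -- Here `1, u, v` exhaust the group-like elements, but cancellation shows that `uv` can equal none
  -- of them: a group of order three has no element of order two.
  · rcases isGroupLikeElem_mem_of_three hB .one hu hvg hu1.symm (Ne.symm e1) (Ne.symm e2)
      (hu.mul hvg) with h | h | h
    · exact e2 (mul_left_cancel_of_isGroupLikeElem hu (h.trans huu.symm))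
    · exact e1 (mul_left_cancel_of_isGroupLikeElem hu (h.trans (mul_one u).symm))
    · exact hu1 (hvg.isUnit.mul_right_cancel (h.trans (one_mul v).symm))

/-- A Hopf algebra of dimension three over an algebraically closed field of characteristic zero
is generated by a group-like element of order three. -/
theorem exists_isGroupLikeElem_order_three [IsAlgClosed k] [CharZero k] (hB : finrank k B = 3) :
    ∃ u : B, IsGroupLikeElem k u ∧ LinearIndependent k ![1, u, u * u] ∧ u * (u * u) = 1 := by
  obtain ⟨p, u, hp0, hpc, hu, hp⟩ := exists_skewPrimitive (k := k) hB
  have hu1 : u ≠ 1 := by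
    rintro rfl
    exact hp0 (primitive_eq_zero hB hp)
  have huu := isGroupLikeElem_mul_self_ne_one hB hu hu1
  have huu' : u ≠ u * u := fun h =>
    hu1 (mul_left_cancel_of_isGroupLikeElem hu (h.symm.trans (mul_one u).symm))
  refine ⟨u, hu, linearIndependent_of_isGroupLikeElem₃ .one hu (hu.mul hu) hu1.symm huu.symm huu',
    ?_⟩
  -- The group-like elements are exactly `1, u, u²`; of these `u³` can only be `1`, by cancellation.
  rcases isGroupLikeElem_mem_of_three hB .one hu (hu.mul hu) hu1.symm huu.symm huu'
    (hu.mul (hu.mul hu)) with h | h | h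
  · exact h
  · exact absurd (mul_left_cancel_of_isGroupLikeElem hu (h.trans (mul_one u).symm)) huu
  · exact absurd (mul_left_cancel_of_isGroupLikeElem hu h).symm huu'

end HopfThree

/-! ### Yetter-Drinfeld modules over `H(2)` -/

/-! ### Coordinates with respect to `p₊` and `p₋`. -/

section Sign

variable (k : Type u) [Field k]

/-- The sign character of `C₂`. -/
def signHom : Multiplicative (ZMod 2) →* k where
  toFun x := if x = 1 then 1 else -1
  map_one' := if_pos rfl
  map_mul' x y := by
    have hx : ∀ x : Multiplicative (ZMod 2), x = 1 ∨ x = Multiplicative.ofAdd 1 := by decide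
    have h1 : (Multiplicative.ofAdd 1 : Multiplicative (ZMod 2)) ≠ 1 := by decide
    have h2 : (Multiplicative.ofAdd 1 * Multiplicative.ofAdd 1 : Multiplicative (ZMod 2)) = 1 := by
      decide
    rcases hx x with rfl | rfl <;> rcases hx y with rfl | rfl <;> simp [h1, h2]

/-- The character of `k[C₂]` with `g ↦ -1`. -/
def sign : KC2 k →ₐ[k] k :=
  (MonoidAlgebra.lift k k (Multiplicative (ZMod 2)) (signHom k) :
    MonoidAlgebra k (Multiplicative (ZMod 2)) →ₐ[k] k)

theorem sign_g : sign k (g k) = -1 := by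
  refine (MonoidAlgebra.lift_single ..).trans ?_
  have h1 : (Multiplicative.ofAdd 1 : Multiplicative (ZMod 2)) ≠ 1 := by decide
  simp [signHom, h1]

variable [CharZero k]

theorem sign_pMinus : sign k (pMinus k) = 1 := by
  rw [pMinus, map_smul, map_sub, map_one, sign_g, smul_eq_mul, sub_neg_eq_add, one_add_one_eq_two,
    inv_mul_cancel₀ two_ne_zero]

theorem sign_pPlus : sign k (pPlus k) = 0 := by
  rw [pPlus, map_smul, map_add, map_one, sign_g, add_neg_cancel, smul_zero]

/-- The counit and the sign character are the basis dual to `p₊, p₋`, so contracting with them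
extracts the components of a tensor in `H(2) ⊗ M`. -/
theorem KC2_eq (h : KC2 k) : h = (H2 k).counit h • pPlus k + sign k h • pMinus k := by
  refine LinearMap.congr_fun (f := LinearMap.id)
    (g := LinearMap.toSpanSingleton k _ (pPlus k) ∘ₗ (H2 k).counit.toLinearMap +
      LinearMap.toSpanSingleton k _ (pMinus k) ∘ₗ (sign k).toLinearMap) (KC2.hom_ext k ?_ ?_) h
  · simp [pPlus_add_pMinus]
  · have h2 : (H2 k).counit (g k) = 1 := counit_g k
    simp only [LinearMap.id_apply, LinearMap.add_apply, LinearMap.comp_apply,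
      AlgHom.toLinearMap_apply, LinearMap.toSpanSingleton_apply, h2, sign_g, one_smul, pPlus_eq,
      neg_smul]
    rw [g_eq, two_smul]
    abel

theorem KC2_tmul_eq {M : Type*} [AddCommGroup M] [Module k M] (τ : KC2 k ⊗[k] M) :
    τ = pPlus k ⊗ₜ contractLeft M (H2 k).counit.toLinearMap τ +
      pMinus k ⊗ₜ contractLeft M (sign k).toLinearMap τ := by
  induction τ with
  | zero => simp
  | add x y hx hy =>
    nth_rw 1 [hx, hy]
    simp only [map_add, TensorProduct.tmul_add]
    abel
  | tmul h m =>
    rw [contractLeft_tmul, contractLeft_tmul, ← TensorProduct.smul_tmul, ← TensorProduct.smul_tmul,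
      ← TensorProduct.add_tmul]
    exact congrArg (· ⊗ₜ m) (KC2_eq k h)

variable {k}

theorem KC2_tmul_inj {M : Type*} [AddCommGroup M] [Module k M] {a b a' b' : M}
    (h : pPlus k ⊗ₜ[k] a + pMinus k ⊗ₜ b = pPlus k ⊗ₜ a' + pMinus k ⊗ₜ b') : a = a' ∧ b = b' := by
  constructor
  · simpa [H2_counit_pMinus, H2_counit_pPlus] using
      congrArg (contractLeft M (H2 k).counit.toLinearMap) h
  · simpa [sign_pMinus, sign_pPlus] using congrArg (contractLeft M (sign k).toLinearMap) h

variable {M N P : Type*} [AddCommGroup M] [Module k M] [AddCommGroup N] [Module k N]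
  [AddCommGroup P] [Module k P]
  (ρ : KC2 k →ₐ[k] Module.End k M) (σ : KC2 k →ₐ[k] Module.End k N)
  (τ : KC2 k →ₐ[k] Module.End k P)

theorem pairAct_Phi2_tmul (a : M) (b : N) (c : P) :
    pairAct ρ (pairAct σ τ) (Phi2 k) (a ⊗ₜ (b ⊗ₜ c)) = a ⊗ₜ (b ⊗ₜ c) -
      (2 : k) • (ρ (pMinus k) a ⊗ₜ (σ (pMinus k) b ⊗ₜ τ (pMinus k) c)) := by
  rw [Phi2, map_sub, map_one, map_smul]
  rfl

theorem H2_associator_tmul (a : M) (b : N) (c : P) :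
    (H2 k).associator ρ σ τ ((a ⊗ₜ b) ⊗ₜ c) = a ⊗ₜ (b ⊗ₜ c) -
      (2 : k) • (ρ (pMinus k) a ⊗ₜ (σ (pMinus k) b ⊗ₜ τ (pMinus k) c)) :=
  pairAct_Phi2_tmul ρ σ τ a b c

theorem H2_associatorInv_tmul (a : M) (b : N) (c : P) :
    (H2 k).associatorInv ρ σ τ (a ⊗ₜ (b ⊗ₜ c)) = (a ⊗ₜ b) ⊗ₜ c -
      (2 : k) • ((ρ (pMinus k) a ⊗ₜ σ (pMinus k) b) ⊗ₜ τ (pMinus k) c) := by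
  rw [QuasiBialgebra.associatorInv, LinearMap.comp_apply]
  refine (congrArg _ (pairAct_Phi2_tmul ρ σ τ a b c)).trans ?_
  rw [map_sub, map_smul]
  rfl

theorem act_pPlus (m : M) : ρ (pPlus k) m = m - ρ (pMinus k) m := by
  rw [pPlus_eq, map_sub, map_one]
  rfl

theorem H2_tensorAct_pMinus (a : M) (b : N) :
    (H2 k).tensorAct ρ σ (pMinus k) (a ⊗ₜ b) =
      ρ (pPlus k) a ⊗ₜ σ (pMinus k) b + ρ (pMinus k) a ⊗ₜ σ (pPlus k) b := by
  rw [QuasiBialgebra.tensorAct, AlgHom.comp_apply, H2_comul_pMinus, map_add]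
  rfl

theorem H2_tensorAct_pPlus (a : M) (b : N) :
    (H2 k).tensorAct ρ σ (pPlus k) (a ⊗ₜ b) =
      ρ (pPlus k) a ⊗ₜ σ (pPlus k) b + ρ (pMinus k) a ⊗ₜ σ (pMinus k) b := by
  rw [QuasiBialgebra.tensorAct, AlgHom.comp_apply, H2_comul_pPlus, map_add]
  rfl

end Sign

/-! ### Parity and twist of a Yetter–Drinfeld module. -/

namespace YDModule

variable {k : Type u} [Field k] [CharZero k] {M : Type w} [AddCommGroup M] [Module k M]
  (X : YDModule (H2 k).toQuasiBialgebra M)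

/-- The projection onto the odd part. -/
def odd : M →ₗ[k] M := X.act (pMinus k)

/-- The map `t` with `m₍₋₁₎ ⊗ m₍₀₎ = p₊ ⊗ m + p₋ ⊗ t(m)`. -/
def twist : M →ₗ[k] M := contractLeft M (sign k).toLinearMap ∘ₗ X.coact

theorem odd_odd (m : M) : X.odd (X.odd m) = X.odd m := by
  rw [odd, ← Module.End.mul_apply, ← map_mul, pMinus_mul]

theorem act_pMinus (m : M) : X.act (pMinus k) m = X.odd m := rfl

theorem act_pPlus' (m : M) : X.act (pPlus k) m = m - X.odd m := act_pPlus _ _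

/-- The counit axiom forces the `p₊`-component to be `m`, so only the `p₋`-component carries
information. -/
theorem coact_eq (m : M) : X.coact m = pPlus k ⊗ₜ m + pMinus k ⊗ₜ X.twist m := by
  have h1 : contractLeft M (H2 k).counit.toLinearMap (X.coact m) = m := X.coact_counit m
  refine (KC2_tmul_eq k (X.coact m)).trans ?_
  rw [h1]
  rfl

theorem braid_tmul {N : Type*} [AddCommGroup N] [Module k N] (σ : KC2 k →ₐ[k] Module.End k N)
    (m : M) (n : N) :
    braid X.coact σ (m ⊗ₜ n) = σ (pPlus k) n ⊗ₜ m + σ (pMinus k) n ⊗ₜ X.twist m :=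
  braid_of_sum _ _ (X.coact_eq m) n

/-- Compatibility of action and coaction for `h = p₋`, read in the `p₋`-component. -/
theorem odd_twist (m : M) : X.odd (X.twist m) = X.twist (X.odd m) := by
  have h := X.act_coact (pMinus k) m
  rw [coact_eq, map_add, H2_tensorAct_pMinus, H2_tensorAct_pMinus, H2_tensorAct_pMinus, map_add,
    braid_tmul, braid_tmul] at h
  simp only [regAct_apply, pPlus_mul, pMinus_mul, pPlus_mul_pMinus, pMinus_mul_pPlus, mul_one,
    TensorProduct.zero_tmul, add_zero, zero_add, act_pMinus, act_pPlus', map_sub] at h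
  have h2 := (KC2_tmul_inj (h.trans (add_comm _ _))).2
  exact sub_right_injective h2

/-- On the `p₋ ⊗ p₋` component with `m` odd, every reassociator in the coassociativity axiom acts by
`-1`: there is one on the left and there are two on the right, so one sign survives. For even `m`
all of them act trivially. -/
theorem twist_twist_of_odd {m : M} (hm : X.odd m = m) : X.twist (X.twist m) = -m := by
  have ht : X.odd (X.twist m) = X.twist m := by rw [odd_twist, hm]
  have h := X.coact_coassoc m
  -- Applying the sign character to both copies of `H(2)` extracts the `p₋ ⊗ p₋` component.
  have h' := congrArg (contractLeft M (sign k).toLinearMap ∘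
    contractLeft (KC2 k ⊗[k] M) (sign k).toLinearMap) h
  rw [coact_eq] at h'
  simp [TensorProduct.add_tmul, H2_associator_tmul, regAct_apply, sign_pMinus, sign_pPlus,
    braid_tmul, act_pMinus, hm, ht, H2_tensorAct_pMinus, H2_tensorAct_pPlus] at h'
  have e : X.twist (X.twist m) = -(X.twist (X.twist m) - (2 : k) • X.twist (X.twist m)) := by module
  rw [e, h']
  module

theorem twist_twist_of_even {m : M} (hm : X.odd m = 0) : X.twist (X.twist m) = m := by
  have ht : X.odd (X.twist m) = 0 := by rw [odd_twist, hm, map_zero]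
  have h := X.coact_coassoc m
  have h' := congrArg (contractLeft M (sign k).toLinearMap ∘
    contractLeft (KC2 k ⊗[k] M) (sign k).toLinearMap) h
  rw [coact_eq] at h'
  simp [TensorProduct.add_tmul, H2_associator_tmul, regAct_apply, sign_pMinus, sign_pPlus,
    braid_tmul, act_pMinus, hm, ht, H2_tensorAct_pMinus, H2_tensorAct_pPlus] at h'
  exact h'

end YDModule

/-! ### Parity in a Yetter–Drinfeld Hopf algebra and the braided product. -/

namespace YDHopfAlgebra

variable {k : Type u} [Field k] [CharZero k] {B : Type w} [AddCommGroup B] [Module k B]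
  (X : YDHopfAlgebra (H2 k).toQuasiBialgebra B)

theorem odd_one : X.odd X.one = 0 := by
  have h := X.act_one (pMinus k)
  rwa [H2_counit_pMinus, zero_smul] at h

theorem twist_one : X.twist X.one = X.one := by
  have h := X.coact_one
  rw [X.coact_eq, ← pPlus_add_pMinus, TensorProduct.add_tmul] at h
  exact (KC2_tmul_inj h).2

theorem odd_mul (a b : B) : X.odd (X.mul (a ⊗ₜ b)) =
    X.mul ((a - X.odd a) ⊗ₜ X.odd b) + X.mul (X.odd a ⊗ₜ (b - X.odd b)) := by
  have h := X.act_mul (pMinus k) (a ⊗ₜ b)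
  rwa [H2_tensorAct_pMinus, map_add, X.act_pPlus', X.act_pPlus'] at h

theorem mul_assoc_tmul (a b c : B) : X.mul (X.mul (a ⊗ₜ b) ⊗ₜ c) =
    X.mul (a ⊗ₜ X.mul (b ⊗ₜ c)) -
      (2 : k) • X.mul (X.odd a ⊗ₜ X.mul (X.odd b ⊗ₜ X.odd c)) := by
  have h := X.mul_assoc ((a ⊗ₜ b) ⊗ₜ c)
  rw [H2_associator_tmul, map_sub, map_sub, map_smul, map_smul] at h
  exact h

theorem counit_odd (b : B) : X.counit (X.odd b) = 0 := by
  have h := X.counit_act (pMinus k) b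
  rwa [H2_counit_pMinus, zero_mul] at h

theorem comul_odd (b : B) : X.comul (X.odd b) =
    TensorProduct.map (LinearMap.id - X.odd) X.odd (X.comul b) +
      TensorProduct.map X.odd (LinearMap.id - X.odd) (X.comul b) := by
  refine (X.comul_act (pMinus k) b).trans ?_
  induction X.comul b with
  | zero => simp
  | add x y hx hy => simp only [map_add, hx, hy]; abel
  | tmul a b =>
    rw [H2_tensorAct_pMinus, X.act_pPlus', X.act_pPlus']
    rfl

/-- The multiplication of the braided tensor product algebra `B ⊗ B`. -/
def tensorMul : (B ⊗[k] B) ⊗[k] (B ⊗[k] B) →ₗ[k] B ⊗[k] B :=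
  TensorProduct.map X.mul X.mul ∘ₗ (H2 k).interchange X.act X.coact

theorem comul_mul_tmul (b b' : B) :
    X.comul (X.mul (b ⊗ₜ b')) = X.tensorMul (X.comul b ⊗ₜ X.comul b') := X.comul_mul b b'

/-- The braiding moves `b` past `a'`: an even `a'` leaves `b` alone, an odd `a'` replaces it by its
twist. A reassociator contributes a sign only on three odd factors. The six parity patterns in this
and the following lemmas cover all the products needed below. -/
theorem tensorMul_of_even_any_even {a a' : B} (b b' : B) (ha : X.odd a = 0) (ha' : X.odd a' = 0) :
    X.tensorMul ((a ⊗ₜ b) ⊗ₜ (a' ⊗ₜ b')) = X.mul (a ⊗ₜ a') ⊗ₜ X.mul (b ⊗ₜ b') := by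
  simp [tensorMul, QuasiBialgebra.interchange, H2_associator_tmul, H2_associatorInv_tmul,
    X.braid_tmul, X.act_pMinus, X.act_pPlus', ha, ha', H2_tensorAct_pMinus]

theorem tensorMul_of_even_any_odd {a a' : B} (b b' : B) (ha : X.odd a = 0) (ha' : X.odd a' = a') :
    X.tensorMul ((a ⊗ₜ b) ⊗ₜ (a' ⊗ₜ b')) = X.mul (a ⊗ₜ a') ⊗ₜ X.mul (X.twist b ⊗ₜ b') := by
  simp [tensorMul, QuasiBialgebra.interchange, H2_associator_tmul, H2_associatorInv_tmul,
    X.braid_tmul, X.act_pMinus, X.act_pPlus', ha, ha', H2_tensorAct_pMinus, X.odd_odd, X.odd_twist,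
    TensorProduct.tmul_smul, TensorProduct.sub_tmul,
    TensorProduct.tmul_sub]
  module

theorem tensorMul_of_even_even {a' b' : B} (a b : B) (ha' : X.odd a' = 0) (hb' : X.odd b' = 0) :
    X.tensorMul ((a ⊗ₜ b) ⊗ₜ (a' ⊗ₜ b')) = X.mul (a ⊗ₜ a') ⊗ₜ X.mul (b ⊗ₜ b') := by
  simp [tensorMul, QuasiBialgebra.interchange, H2_associator_tmul, H2_associatorInv_tmul,
    X.braid_tmul, X.act_pMinus, X.act_pPlus', ha', hb', H2_tensorAct_pMinus]

theorem tensorMul_of_odd_even {a' b' : B} (a b : B) (ha' : X.odd a' = a') (hb' : X.odd b' = 0) :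
    X.tensorMul ((a ⊗ₜ b) ⊗ₜ (a' ⊗ₜ b')) = X.mul (a ⊗ₜ a') ⊗ₜ X.mul (X.twist b ⊗ₜ b') := by
  simp [tensorMul, QuasiBialgebra.interchange, H2_associator_tmul, H2_associatorInv_tmul,
    X.braid_tmul, X.act_pMinus, X.act_pPlus', ha', hb', H2_tensorAct_pMinus, X.odd_odd, X.odd_twist]
  module

theorem tensorMul_of_even_even' {b a' : B} (a b' : B) (hb : X.odd b = 0) (ha' : X.odd a' = 0) :
    X.tensorMul ((a ⊗ₜ b) ⊗ₜ (a' ⊗ₜ b')) = X.mul (a ⊗ₜ a') ⊗ₜ X.mul (b ⊗ₜ b') := by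
  simp [tensorMul, QuasiBialgebra.interchange, H2_associator_tmul, H2_associatorInv_tmul,
    X.braid_tmul, X.act_pMinus, X.act_pPlus', hb, ha', H2_tensorAct_pMinus]

/-- The sign comes from the final inverse associator, applied to the odd factors `a`, `a'` and `t(b)
⊗ b'`. -/
theorem tensorMul_of_odd_even_odd_odd {a b a' b' : B} (ha : X.odd a = a) (hb : X.odd b = 0)
    (ha' : X.odd a' = a') (hb' : X.odd b' = b') :
    X.tensorMul ((a ⊗ₜ b) ⊗ₜ (a' ⊗ₜ b')) =
      -(X.mul (a ⊗ₜ a') ⊗ₜ X.mul (X.twist b ⊗ₜ b')) := by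
  simp [tensorMul, QuasiBialgebra.interchange, H2_associator_tmul, H2_associatorInv_tmul,
    X.braid_tmul, X.act_pMinus, X.act_pPlus', ha, hb, ha', hb', H2_tensorAct_pMinus, X.odd_twist]
  module

theorem counit_eq_zero_of_odd {x : B} (hx : X.odd x = x) : X.counit x = 0 := by
  rw [← hx, X.counit_odd]

theorem odd_mul_of_odd {x y : B} (hx : X.odd x = x) (hy : X.odd y = y) :
    X.odd (X.mul (x ⊗ₜ y)) = 0 := by
  rw [odd_mul, hx, hy]; simp

theorem odd_mul_of_even {x y : B} (hx : X.odd x = 0) (hy : X.odd y = 0) :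
    X.odd (X.mul (x ⊗ₜ y)) = 0 := by
  rw [odd_mul, hx, hy]; simp

theorem odd_mul_of_even_odd {x y : B} (hx : X.odd x = 0) (hy : X.odd y = y) :
    X.odd (X.mul (x ⊗ₜ y)) = X.mul (x ⊗ₜ y) := by
  rw [odd_mul, hx, hy]; simp

theorem odd_mul_of_odd_even {x y : B} (hx : X.odd x = x) (hy : X.odd y = 0) :
    X.odd (X.mul (x ⊗ₜ y)) = X.mul (x ⊗ₜ y) := by
  rw [odd_mul, hx, hy]; simp

/-- If the even part is spanned by the unit, then there are no odd elements. -/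
theorem eq_zero_of_odd_of_even_scalar (hE : ∀ b, X.odd b = 0 → b = X.counit b • X.one) {x : B}
    (hx : X.odd x = x) : x = 0 := by
  have hE' : ∀ b, b - X.odd b = X.counit b • X.one := fun b => by
    have h := hE (b - X.odd b) (by rw [map_sub, X.odd_odd, sub_self])
    rwa [map_sub, X.counit_odd, sub_zero] at h
  -- The coproduct of an odd element lies in even ⊗ odd plus odd ⊗ even. As the even projection is
  -- `b ↦ ε(b)1`, the counit axioms determine both terms.
  have hΔ : X.comul x = X.one ⊗ₜ x + x ⊗ₜ X.one := by
    have h1 : ∀ τ : B ⊗[k] B, TensorProduct.map (LinearMap.id - X.odd) X.odd τ =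
        X.one ⊗ₜ X.odd (contractLeft B X.counit τ) := by
      intro τ
      induction τ with
      | zero => simp
      | add a b ha hb => simp only [map_add, ha, hb, TensorProduct.tmul_add]
      | tmul a b => simp [hE', TensorProduct.smul_tmul]
    have h2 : ∀ τ : B ⊗[k] B, TensorProduct.map X.odd (LinearMap.id - X.odd) τ =
        X.odd (contractRight B X.counit τ) ⊗ₜ X.one := by
      intro τ
      induction τ with
      | zero => simp
      | add a b ha hb => simp only [map_add, ha, hb, TensorProduct.add_tmul]
      | tmul a b => simp [hE', TensorProduct.smul_tmul]
    have h3 := X.comul_odd x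
    have h4 : contractLeft B X.counit (X.comul x) = x := X.counit_left x
    have h5 : contractRight B X.counit (X.comul x) = x := X.counit_right x
    rwa [h1, h2, h4, h5, hx] at h3
  have hxx : X.mul (x ⊗ₜ x) = 0 := by
    rw [hE _ (X.odd_mul_of_odd hx hx), X.counit_mul, X.counit_eq_zero_of_odd hx, zero_mul,
      zero_smul]
  -- Expanding `0 = Δ(x²)` leaves `x ⊗ (t(x) + x) = 0`, because `(1 ⊗ x)(x ⊗ 1) = x ⊗ t(x)`.
  have h := X.comul_mul_tmul x x
  have h1 := X.odd_one
  rw [hxx, hΔ, map_zero, TensorProduct.add_tmul, TensorProduct.tmul_add, TensorProduct.tmul_add,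
    map_add, map_add, map_add, X.tensorMul_of_even_any_even _ _ h1 h1,
    X.tensorMul_of_even_any_odd _ _ h1 hx, X.tensorMul_of_even_even' _ _ h1 h1,
    X.tensorMul_of_odd_even _ _ hx h1, X.twist_one] at h
  simp only [X.one_mul, X.mul_one, hxx, TensorProduct.tmul_zero, TensorProduct.zero_tmul,
    zero_add, add_zero, ← TensorProduct.tmul_add] at h
  by_contra hne
  have ht : X.twist x + x = 0 := by
    obtain ⟨f, hf⟩ : ∃ f : Module.Dual k B, f x ≠ 0 := by
      by_contra! hf
      exact hne ((Module.forall_dual_apply_eq_zero_iff k x).1 hf)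
    have h2 := congrArg (contractLeft B f) h.symm
    rw [contractLeft_tmul, map_zero] at h2
    exact (smul_eq_zero.1 h2).resolve_left hf
  have ht' : X.twist x = -x := eq_neg_of_add_eq_zero_left ht
  have h2 := X.twist_twist_of_odd hx
  rw [ht', map_neg, ht', neg_neg] at h2
  refine hne ?_
  have h3 : (2 : k) • x = 0 := by
    rw [two_smul]
    nth_rw 1 [h2]
    exact neg_add_cancel x
  exact (smul_eq_zero.1 h3).resolve_left two_ne_zero

open Module

/-! ### Excluding a basis `1, y, x` with `y` even and `x` odd. -/

section OneOdd

variable {X} {x y : B}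

theorem even_eq (hB : finrank k B = 3) (hli : LinearIndependent k ![X.one, y, x])
    (hx : X.odd x = x) (hy : X.odd y = 0) {b : B} (hb : X.odd b = 0) :
    ∃ r s : k, b = r • X.one + s • y := by
  obtain ⟨r, s, t, rfl⟩ := exists_coeff_of_three hB hli b
  obtain ⟨-, -, f, -, -, -, -, hf⟩ := exists_dual_of_three hli
  have ht : t = 0 := by
    simpa [X.odd_one, hx, hy, hf] using congrArg f hb
  exact ⟨r, s, by rw [ht, zero_smul, add_zero]⟩

theorem even_eq_of_counit (hB : finrank k B = 3) (hli : LinearIndependent k ![X.one, y, x])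
    (hx : X.odd x = x) (hy : X.odd y = 0) (hy0 : X.counit y = 0) {b : B} (hb : X.odd b = 0)
    (hb0 : X.counit b = 0) : ∃ s : k, b = s • y := by
  obtain ⟨r, s, rfl⟩ := even_eq hB hli hx hy hb
  have hr : r = 0 := by simpa [hy0, X.counit_one] using hb0
  exact ⟨s, by rw [hr, zero_smul, zero_add]⟩

theorem odd_eq (hB : finrank k B = 3) (hli : LinearIndependent k ![X.one, y, x])
    (hx : X.odd x = x) (hy : X.odd y = 0) {b : B} (hb : X.odd b = b) : ∃ t : k, b = t • x := by
  obtain ⟨r, s, t, h⟩ := exists_coeff_of_three hB hli b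
  exact ⟨t, by rw [← hb, h, map_add, map_add, map_smul, map_smul, map_smul, X.odd_one, hx, hy]; simp⟩

theorem odd_comul (b : B) {r s t : B} (hx : X.odd x = x) (hy : X.odd y = 0)
    (h : X.comul b = X.one ⊗ₜ r + y ⊗ₜ s + x ⊗ₜ t) :
    X.comul (X.odd b) = X.one ⊗ₜ X.odd r + y ⊗ₜ X.odd s + x ⊗ₜ (t - X.odd t) := by
  rw [comul_odd, h]
  simp [X.odd_one, hx, hy]

/-- Oddness of `Δ(x)` makes the partners of `1` and `y` odd and that of `x` even; the counit axioms
normalise the coefficients of `1 ⊗ x` and `x ⊗ 1` to one. -/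
theorem exists_comul_odd (hB : finrank k B = 3) (hli : LinearIndependent k ![X.one, y, x])
    (hx : X.odd x = x) (hy : X.odd y = 0) (hy0 : X.counit y = 0) :
    ∃ μ ν : k, X.comul x = X.one ⊗ₜ x + y ⊗ₜ (μ • x) + x ⊗ₜ (X.one + ν • y) := by
  obtain ⟨r, s, t, h⟩ := exists_tmul_of_three hB hli (X.comul x)
  have h2 := odd_comul x hx hy h
  rw [hx, h] at h2
  obtain ⟨hr, hs, ht⟩ := tmul_inj_of_three hli h2
  have hx0 := X.counit_eq_zero_of_odd hx
  have hl : contractLeft B X.counit (X.comul x) = x := X.counit_left x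
  rw [h] at hl
  simp only [map_add, contractLeft_tmul, X.counit_one, hy0, hx0, one_smul, zero_smul,
    add_zero] at hl
  obtain ⟨μ, rfl⟩ := odd_eq hB hli hx hy hs.symm
  obtain ⟨τ, ν, rfl⟩ := even_eq hB hli hx hy (sub_eq_self.1 ht.symm)
  obtain ⟨-, -, f, -, -, hf⟩ := exists_dual_of_three hli
  have hr' : contractRight B X.counit (X.comul x) = x := X.counit_right x
  have hτ : τ = 1 := by
    have := congrArg f hr'
    simpa [h, X.counit_one, hy0, hf] using this
  exact ⟨μ, ν, by rw [h, hl, hτ, one_smul]⟩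

theorem exists_comul_even (hB : finrank k B = 3) (hli : LinearIndependent k ![X.one, y, x])
    (hx : X.odd x = x) (hy : X.odd y = 0) (hy0 : X.counit y = 0) :
    ∃ κ φ : k, X.comul y = X.one ⊗ₜ y + y ⊗ₜ (X.one + κ • y) + x ⊗ₜ (φ • x) := by
  obtain ⟨r, s, t, h⟩ := exists_tmul_of_three hB hli (X.comul y)
  have h2 := odd_comul y hx hy h
  rw [hy, map_zero] at h2
  obtain ⟨hr, hs, ht⟩ := tmul_inj_of_three hli (r := 0) (s := 0) (t := 0)
    ((by simp : _ = (0 : B ⊗[k] B)).trans h2)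
  have hx0 := X.counit_eq_zero_of_odd hx
  have hl : contractLeft B X.counit (X.comul y) = y := X.counit_left y
  rw [h] at hl
  simp only [map_add, contractLeft_tmul, X.counit_one, hy0, hx0, one_smul, zero_smul,
    add_zero] at hl
  obtain ⟨σ, κ, rfl⟩ := even_eq hB hli hx hy hs.symm
  obtain ⟨φ, rfl⟩ := odd_eq hB hli hx hy (sub_eq_zero.1 ht.symm).symm
  obtain ⟨-, f, -, -, hf, -⟩ := exists_dual_of_three hli
  have hr' : contractRight B X.counit (X.comul y) = y := X.counit_right y
  have hσ : σ = 1 := by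
    have := congrArg f hr'
    simpa [h, X.counit_one, hy0, hx0, hf] using this
  exact ⟨κ, φ, by rw [h, hl, hσ, one_smul]⟩

/-- The structure constants of a Hopf algebra with a one-dimensional odd part do not exist. -/
theorem structure_constants_false {q α β γ δ μ ν κ φ : k} (hq : q * q = -1)
    (h1 : δ * α = -(δ * β)) (h2 : α * δ = δ * γ) (h3 : δ * γ = β * δ)
    (h4 : γ * α = α * α) (h5 : γ * β = β * β)
    (k1 : μ * κ = μ * μ) (k2 : ν * ν = ν * κ) (k3 : -(μ * φ) = ν * φ)
    (k4 : φ * μ = κ * φ) (k5 : κ * φ = φ * ν)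
    (m1 : δ * φ = q * ((1 + μ * α) * (1 + ν * β)) + (1 + μ * β) * (1 + ν * α))
    (m2 : μ = 0 → ν = 0 → κ = 0 → α = 0 → β = 0 → γ = 0 → φ * δ = 1)
    (m3 : δ = 0 → φ = 0 → γ * κ = 2 + 4 * (κ * γ) + κ * γ * (κ * γ))
    (m4 : φ = 0 → κ * γ ≠ -1) : False := by
  have hq0 : q ≠ 0 := by rintro rfl; simp at hq
  -- Each case below ends with `q ∈ {0, 1, -1}`, which `q² = -1` excludes.
  have hq1 : q ≠ -1 := by rintro rfl; norm_num at hq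
  have hq1' : q ≠ 1 := by rintro rfl; norm_num at hq
  by_cases hφ : φ = 0
  · by_cases hδ : δ = 0
    · have h6 := m3 hδ hφ
      -- In this case `1 + κy` is group-like, and `κγ = -2` says that its square is `1`. The other
      -- root `κγ = -1` would give `y(1 + κy) = 0`.
      have hs : κ * γ = -2 := by
        have : (κ * γ + 1) * (κ * γ + 2) = 0 := by linear_combination -h6
        rcases mul_eq_zero.1 this with h | h
        · exact absurd (eq_neg_of_add_eq_zero_left h) (m4 hφ)
        · exact eq_neg_of_add_eq_zero_left h
      rw [hδ, zero_mul] at m1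
      have cα : α = 0 ∨ α = γ := by
        have : α * (α - γ) = 0 := by linear_combination -h4
        exact (mul_eq_zero.1 this).imp_right sub_eq_zero.1
      have cβ : β = 0 ∨ β = γ := by
        have : β * (β - γ) = 0 := by linear_combination -h5
        exact (mul_eq_zero.1 this).imp_right sub_eq_zero.1
      have cμ : μ = 0 ∨ μ = κ := by
        have : μ * (μ - κ) = 0 := by linear_combination -k1
        exact (mul_eq_zero.1 this).imp_right sub_eq_zero.1
      have cν : ν = 0 ∨ ν = κ := by
        have : ν * (ν - κ) = 0 := by linear_combination k2
        exact (mul_eq_zero.1 this).imp_right sub_eq_zero.1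
      -- Each factor of `m1` is now `1` or `1 - 2 = -1`, so `m1` reads `0 = ±q ± 1`.
      rcases cα with rfl | rfl <;> rcases cβ with rfl | rfl <;> rcases cμ with rfl | rfl <;>
        rcases cν with rfl | rfl <;> simp only [hs, mul_zero, zero_mul, add_zero] at m1 <;>
        first
          | exact hq1 (by linear_combination -m1)
          | exact hq1' (by linear_combination -m1)
          | exact hq1' (by linear_combination m1)
          | exact hq1 (by linear_combination m1)
    -- A nonzero `δ` kills `α, β, γ`: the sign of the reassociator in `(xx)x` gives `α = -β`, while
    -- the other two relations give `α = γ = β`.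
    · have hαβ : α = -β := mul_left_cancel₀ hδ (by linear_combination h1)
      have hαγ : α = γ := mul_left_cancel₀ hδ (by linear_combination h2)
      have hβγ : β = γ := mul_left_cancel₀ hδ (by linear_combination -h3)
      have hγ : γ = 0 := by
        have : (2 : k) * γ = 0 := by linear_combination -hαγ + hαβ - hβγ
        exact (mul_eq_zero.1 this).resolve_left two_ne_zero
      rw [hφ, hαγ, hβγ, hγ] at m1
      exact hq1 (by linear_combination -m1)
  -- Dually, a nonzero `φ` kills `μ, ν, κ`.
  · have hμν : μ = -ν := mul_left_cancel₀ hφ (by linear_combination -k3)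
    have hμκ : μ = κ := mul_left_cancel₀ hφ (by linear_combination k4)
    have hκν : κ = ν := mul_left_cancel₀ hφ (by linear_combination k5)
    have hν : ν = 0 := by
      have : (2 : k) * ν = 0 := by linear_combination -hμκ + hμν - hκν
      exact (mul_eq_zero.1 this).resolve_left two_ne_zero
    have hκ : κ = 0 := hκν.trans hν
    have hμ : μ = 0 := hμκ.trans hκ
    by_cases hδ : δ = 0
    · rw [hδ, hμ, hν] at m1
      exact hq1 (by linear_combination -m1)
    · have hαβ : α = -β := mul_left_cancel₀ hδ (by linear_combination h1)
      have hαγ : α = γ := mul_left_cancel₀ hδ (by linear_combination h2)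
      have hβγ : β = γ := mul_left_cancel₀ hδ (by linear_combination -h3)
      have hγ : γ = 0 := by
        have : (2 : k) * γ = 0 := by linear_combination -hαγ + hαβ - hβγ
        exact (mul_eq_zero.1 this).resolve_left two_ne_zero
      -- With all other constants zero, `m1` says `δφ = q + 1` and `m2` says `φδ = 1`, so `q = 0`.
      have h7 := m2 hμ hν hκ (hαγ.trans hγ) (hβγ.trans hγ) hγ
      rw [hμ, hν] at m1
      exact hq0 (by linear_combination -m1 + h7)

-- Parity and the counit reduce the structure to `t(x) = qx`, `yx = αx`, `xy = βx`, `y² = γy`, `x² =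
-- δy`, `Δ(x) = 1 ⊗ x + μ y ⊗ x + x ⊗ (1 + νy)` and `Δ(y) = 1 ⊗ y + y ⊗ (1 + κy) + φ x ⊗ x`. The
-- axioms, read coordinatewise, are the hypotheses of `structure_constants_false`.
set_option linter.unusedSimpArgs false in
theorem false_of_one_odd (hB : finrank k B = 3) (hli : LinearIndependent k ![X.one, y, x])
    (hx : X.odd x = x) (hy : X.odd y = 0) (hy0 : X.counit y = 0) : False := by
  have h1 := X.odd_one
  have hx0 := X.counit_eq_zero_of_odd hx
  -- The functionals are dual to `1`, `y`, `x` in this order: `f₂` reads `y` and `f₃` reads `x`.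
  obtain ⟨f₁, f₂, f₃, hf₁, hf₂, hf₃⟩ := exists_dual_of_three hli
  obtain ⟨q, hq⟩ := odd_eq hB hli hx hy (b := X.twist x) (by rw [X.odd_twist, hx])
  obtain ⟨α, hα⟩ := odd_eq hB hli hx hy (X.odd_mul_of_even_odd hy hx)
  obtain ⟨β, hβ⟩ := odd_eq hB hli hx hy (X.odd_mul_of_odd_even hx hy)
  obtain ⟨γ, hγ⟩ := even_eq_of_counit hB hli hx hy hy0 (X.odd_mul_of_even hy hy)
    (by rw [X.counit_mul, hy0, zero_mul])
  obtain ⟨δ, hδ⟩ := even_eq_of_counit hB hli hx hy hy0 (X.odd_mul_of_odd hx hx)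
    (by rw [X.counit_mul, hx0, zero_mul])
  obtain ⟨μ, ν, hΔx⟩ := exists_comul_odd hB hli hx hy hy0
  obtain ⟨κ, φ, hΔy⟩ := exists_comul_even hB hli hx hy hy0
  refine structure_constants_false (k := k) (q := q) (α := α) (β := β) (γ := γ) (δ := δ) (μ := μ)
    (ν := ν) (κ := κ) (φ := φ) ?_ ?_ ?_ ?_ ?_ ?_ ?_ ?_ ?_ ?_ ?_ ?_ ?_ ?_ ?_
  · have h := congrArg f₃ (X.twist_twist_of_odd hx)
    simpa [hq, hf₃] using h
  · have h := congrArg f₃ (X.mul_assoc_tmul x x x)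
    simp [hδ, hx, hα, hβ, ← TensorProduct.smul_tmul', hf₃] at h
    linear_combination h
  · have h := congrArg f₂ (X.mul_assoc_tmul y x x)
    simpa [hδ, hx, hy, hα, hβ, hγ, ← TensorProduct.smul_tmul', hf₂] using h
  · have h := congrArg f₂ (X.mul_assoc_tmul x x y)
    simpa [hδ, hx, hy, hα, hβ, hγ, ← TensorProduct.smul_tmul', hf₂] using h
  · have h := congrArg f₃ (X.mul_assoc_tmul y y x)
    simpa [hδ, hx, hy, hα, hβ, hγ, ← TensorProduct.smul_tmul', hf₃] using h
  · have h := congrArg f₃ (X.mul_assoc_tmul x y y)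
    simp [hx, hy, hβ, hγ, ← TensorProduct.smul_tmul', hf₃] at h
    rcases h with rfl | rfl <;> simp
  · have h := congrArg (fun τ => f₃ (contractLeft B f₂ (contractLeft (B ⊗[k] B) f₂ τ)))
      (X.coassoc x)
    simp [hΔx, hΔy, TensorProduct.add_tmul, TensorProduct.tmul_add, H2_associator_tmul,
      ← TensorProduct.smul_tmul', X.act_pMinus, hx, hy, h1, X.comul_one, hf₂, hf₃] at h
    rcases h with rfl | rfl <;> simp
  · have h := congrArg (fun τ => f₂ (contractLeft B f₂ (contractLeft (B ⊗[k] B) f₃ τ)))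
      (X.coassoc x)
    simp [hΔx, hΔy, TensorProduct.add_tmul, TensorProduct.tmul_add, H2_associator_tmul,
      ← TensorProduct.smul_tmul', X.act_pMinus, hx, hy, h1, X.comul_one, hf₂, hf₃] at h
    rcases h with rfl | rfl <;> simp
  · have h := congrArg (fun τ => f₃ (contractLeft B f₃ (contractLeft (B ⊗[k] B) f₃ τ)))
      (X.coassoc x)
    simp [hΔx, hΔy, TensorProduct.add_tmul, TensorProduct.tmul_add, H2_associator_tmul,
      ← TensorProduct.smul_tmul', X.act_pMinus, hx, hy, h1, X.comul_one, hf₂, hf₃] at h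
    linear_combination h
  · have h := congrArg (fun τ => f₃ (contractLeft B f₃ (contractLeft (B ⊗[k] B) f₂ τ)))
      (X.coassoc y)
    simp [hΔx, hΔy, TensorProduct.add_tmul, TensorProduct.tmul_add, H2_associator_tmul,
      ← TensorProduct.smul_tmul', X.act_pMinus, hx, hy, h1, X.comul_one, hf₂, hf₃] at h
    linear_combination h
  · have h := congrArg (fun τ => f₂ (contractLeft B f₃ (contractLeft (B ⊗[k] B) f₃ τ)))
      (X.coassoc y)
    simp [hΔx, hΔy, TensorProduct.add_tmul, TensorProduct.tmul_add, H2_associator_tmul,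
      ← TensorProduct.smul_tmul', X.act_pMinus, hx, hy, h1, X.comul_one, hf₂, hf₃] at h
    linear_combination h
  -- Coefficient of `x ⊗ x` in `Δ(x²) = Δ(x)Δ(x)`; here `q` enters through the braiding.
  · have h := congrArg (fun τ => f₃ (contractLeft B f₃ τ)) (X.comul_mul_tmul x x)
    simp [hΔx, hΔy, TensorProduct.add_tmul, TensorProduct.tmul_add, hx, hy, h1, hα, hβ, hγ, hδ, hq,
      ← TensorProduct.smul_tmul', X.one_mul, X.mul_one, X.twist_one,
      X.tensorMul_of_even_any_even, X.tensorMul_of_even_any_odd, X.tensorMul_of_even_even,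
      X.tensorMul_of_odd_even, X.tensorMul_of_even_even', X.tensorMul_of_odd_even_odd_odd,
      hf₁, hf₂, hf₃] at h
    linear_combination h
  · rintro rfl rfl rfl rfl rfl rfl
    -- Coefficient of `y ⊗ x` in `Δ(xy) = 0`: `(1 ⊗ x)(y ⊗ 1)` contributes `1` and `(x ⊗ 1)(φ x ⊗
    -- x)` contributes `-φδ`.
    have h := congrArg (fun τ => f₃ (contractLeft B f₂ τ)) (X.comul_mul_tmul x y)
    simp [hΔx, hΔy, TensorProduct.add_tmul, TensorProduct.tmul_add, hx, hy, h1, hα, hβ, hγ, hδ, hq,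
      ← TensorProduct.smul_tmul', X.one_mul, X.mul_one, X.twist_one,
      X.tensorMul_of_even_any_even, X.tensorMul_of_even_any_odd, X.tensorMul_of_even_even,
      X.tensorMul_of_odd_even, X.tensorMul_of_even_even', X.tensorMul_of_odd_even_odd_odd,
      hf₁, hf₂, hf₃] at h
    linear_combination h
  · rintro rfl rfl
    -- Coefficient of `y ⊗ y` in `Δ(y²) = Δ(y)Δ(y)`.
    have h := congrArg (fun τ => f₂ (contractLeft B f₂ τ)) (X.comul_mul_tmul y y)
    simp [hΔx, hΔy, TensorProduct.add_tmul, TensorProduct.tmul_add, hx, hy, h1, hα, hβ, hγ, hδ, hq,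
      ← TensorProduct.smul_tmul', X.one_mul, X.mul_one, X.twist_one,
      X.tensorMul_of_even_any_even, X.tensorMul_of_even_any_odd, X.tensorMul_of_even_even,
      X.tensorMul_of_odd_even, X.tensorMul_of_even_even', X.tensorMul_of_odd_even_odd_odd,
      hf₁, hf₂, hf₃] at h
    linear_combination h
  · rintro rfl hs
    obtain ⟨S, hS, -, hSl, -⟩ := X.exists_antipode
    have hS1 : S X.one = X.one := by
      simpa [X.comul_one, X.counit_one, X.mul_one] using hSl X.one
    -- The antipode preserves parity, so `S(y) = e1 + cy`. In `S(y₁)y₂ = 0` the coordinates give `e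
    -- = 0` and `1 + c(1 + κγ) = 0`, which is impossible for `κγ = -1`.
    obtain ⟨e, c, hec⟩ := even_eq hB hli hx hy (b := S y) (by
      refine (hS (pMinus k) y).symm.trans ?_
      rw [X.act_pMinus, hy, map_zero])
    have h := hSl y
    simp only [hΔy, map_add, TensorProduct.map_tmul, LinearMap.id_apply, hS1, hec, X.one_mul,
      TensorProduct.tmul_add, TensorProduct.add_tmul, TensorProduct.tmul_smul,
      ← TensorProduct.smul_tmul', map_smul, X.mul_one, hγ, zero_smul, hy0] at h
    have he := congrArg f₁ h
    have hc := congrArg f₂ h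
    simp [hf₁, hf₂] at he hc
    rw [he] at hc
    exact one_ne_zero (α := k) (by linear_combination hc - c * hs)

end OneOdd

theorem odd_eq_zero (hB : finrank k B = 3) (b : B) : X.odd b = 0 := by
  by_contra hb
  set x := X.odd b with hxb
  have hx : X.odd x = x := X.odd_odd b
  -- Either `1, y, x` is a basis, or the even part is spanned by the unit.
  by_cases hy : ∃ y, X.odd y = 0 ∧ X.counit y = 0 ∧ y ≠ 0
  · obtain ⟨y, hy, hy0, hne⟩ := hy
    refine false_of_one_odd (X := X) hB (Fintype.linearIndependent_iff.2 fun c hc => ?_) hx hy hy0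
    simp only [Fin.sum_univ_three, Matrix.cons_val] at hc
    have hc0 : c 0 = 0 := by
      simpa [X.counit_one, hy0, X.counit_eq_zero_of_odd hx] using congrArg X.counit hc
    have hc2 : c 2 = 0 := by
      simpa [X.odd_one, hy, hx, hb] using congrArg X.odd hc
    have hc1 : c 1 = 0 := by
      simpa [hc0, hc2, hne] using hc
    intro i
    fin_cases i
    exacts [hc0, hc1, hc2]
  · refine hb (X.eq_zero_of_odd_of_even_scalar (fun b hb => ?_) hx)
    by_contra hne
    exact hy ⟨b - X.counit b • X.one, by rw [map_sub, map_smul, hb, X.odd_one]; simp,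
      by rw [map_sub, map_smul, X.counit_one]; simp, sub_ne_zero.2 hne⟩

theorem act_eq_of_odd_eq_zero (h0 : ∀ b, X.odd b = 0) (h : KC2 k) (b : B) :
    X.act h b = (H2 k).counit h • b := by
  rw [KC2_eq k h, map_add, map_smul, map_smul]
  simp [X.act_pMinus, X.act_pPlus', h0, H2_counit_pMinus, H2_counit_pPlus]

/-- The underlying space of a Yetter-Drinfeld Hopf algebra with no odd elements, as an ordinary
Hopf algebra. -/
def Ordinary (_ : ∀ b, X.odd b = 0) : Type w := B

/-! ### Reduction to ordinary Hopf algebras when there are no odd elements. -/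

section Ordinary

variable (h0 : ∀ b, X.odd b = 0)

instance : AddCommGroup (X.Ordinary h0) := inferInstanceAs (AddCommGroup B)

instance : Module k (X.Ordinary h0) := inferInstanceAs (Module k B)

instance : Ring (X.Ordinary h0) :=
  { (inferInstance : AddCommGroup (X.Ordinary h0)) with
    mul := fun a b => X.mul ((show B from a) ⊗ₜ (show B from b))
    one := X.one
    mul_assoc := fun (a b c : B) => by
      refine (X.mul_assoc_tmul a b c).trans ?_
      rw [h0 a, TensorProduct.zero_tmul, map_zero, smul_zero, sub_zero]
      rfl
    one_mul := fun (a : B) => X.one_mul a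
    mul_one := fun (a : B) => X.mul_one a
    left_distrib := fun (a b c : B) =>
      (congrArg X.mul (TensorProduct.tmul_add a b c)).trans (map_add X.mul _ _)
    right_distrib := fun (a b c : B) =>
      (congrArg X.mul (TensorProduct.add_tmul a b c)).trans (map_add X.mul _ _)
    zero_mul := fun (a : B) =>
      (congrArg X.mul (TensorProduct.zero_tmul B a)).trans (map_zero X.mul)
    mul_zero := fun (a : B) =>
      (congrArg X.mul (TensorProduct.tmul_zero B a)).trans (map_zero X.mul) }

instance : Algebra k (X.Ordinary h0) :=
  Algebra.ofModule
    (fun r (a b : B) => (congrArg X.mul (TensorProduct.smul_tmul' r a b).symm).trans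
      (map_smul X.mul r _))
    (fun r (a b : B) => (congrArg X.mul (TensorProduct.tmul_smul r a b)).trans
      (map_smul X.mul r _))

instance : Coalgebra k (X.Ordinary h0) where
  comul := X.comul
  counit := X.counit
  coassoc := by
    refine LinearMap.ext fun b => ?_
    have h := X.coassoc b
    rw [associator_eq _ _ _ (Or.inl (LinearMap.ext h0))] at h
    exact h
  rTensor_counit_comp_comul := by
    refine LinearMap.ext fun b => (TensorProduct.lid k B).injective ?_
    refine (X.counit_left b).trans ?_
    exact (one_smul k b).symm
  lTensor_counit_comp_comul := by
    refine LinearMap.ext fun b => (TensorProduct.rid k B).injective ?_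
    refine (X.counit_right b).trans ?_
    exact (one_smul k b).symm

theorem tensorMul_eq (h0 : ∀ b, X.odd b = 0) (s t : B ⊗[k] B) : X.tensorMul (s ⊗ₜ t) =
    TensorProduct.map X.mul X.mul (TensorProduct.tensorTensorTensorComm k B B B B (s ⊗ₜ t)) := by
  induction s with
  | zero => simp
  | add s s' hs hs' => rw [TensorProduct.add_tmul, map_add, map_add, map_add, hs, hs']
  | tmul a b =>
    induction t with
    | zero => simp
    | add s s' hs hs' => rw [TensorProduct.tmul_add, map_add, map_add, map_add, hs, hs']
    | tmul c d => exact X.tensorMul_of_even_any_even _ _ (h0 _) (h0 _)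

theorem Ordinary.mul'_eq : LinearMap.mul' k (X.Ordinary h0) = X.mul :=
  TensorProduct.ext' fun _ _ => rfl

theorem Ordinary.comul_mul (a b : X.Ordinary h0) :
    Coalgebra.comul (R := k) (a * b) = Coalgebra.comul (R := k) a * Coalgebra.comul (R := k) b := by
  rw [← LinearMap.mul'_apply (R := k) (a := Coalgebra.comul (R := k) a), LinearMap.mul'_tensor, Ordinary.mul'_eq]
  exact (X.comul_mul_tmul a b).trans (X.tensorMul_eq h0 _ _)

instance : Bialgebra k (X.Ordinary h0) :=
  Bialgebra.mk' k (X.Ordinary h0) X.counit_one (fun {a b} => X.counit_mul a b) X.comul_one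
    (fun {a b} => Ordinary.comul_mul X h0 a b)

instance : HopfAlgebra k (X.Ordinary h0) where
  antipode := X.exists_antipode.choose
  mul_antipode_rTensor_comul := by
    refine LinearMap.ext fun b => ?_
    rw [Ordinary.mul'_eq, LinearMap.comp_apply (Algebra.linearMap _ _),
      Algebra.linearMap_apply, Algebra.algebraMap_eq_smul_one]
    exact X.exists_antipode.choose_spec.2.2.1 b
  mul_antipode_lTensor_comul := by
    refine LinearMap.ext fun b => ?_
    rw [Ordinary.mul'_eq, LinearMap.comp_apply (Algebra.linearMap _ _),
      Algebra.linearMap_apply, Algebra.algebraMap_eq_smul_one]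
    exact X.exists_antipode.choose_spec.2.2.2 b

/-- The final clause, that there are no further group-like elements, later restricts the twist of
the generator. -/
theorem exists_generator [IsAlgClosed k] (h0 : ∀ b, X.odd b = 0) (hB : finrank k B = 3) :
    ∃ u : B, X.counit u = 1 ∧ X.comul u = u ⊗ₜ u ∧
      LinearIndependent k ![X.one, u, X.mul (u ⊗ₜ u)] ∧
      X.mul (u ⊗ₜ X.mul (u ⊗ₜ u)) = X.one ∧
      ∀ v, X.counit v = 1 → X.comul v = v ⊗ₜ v → v = X.one ∨ v = u ∨ v = X.mul (u ⊗ₜ u) := by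
  obtain ⟨u, hu, hli, huuu⟩ :=
    exists_isGroupLikeElem_order_three (k := k) (B := X.Ordinary h0) hB
  have hne : Function.Injective ![1, u, u * u] := hli.injective
  refine ⟨u, hu.counit_eq_one, hu.comul_eq_tmul_self, hli, huuu, fun v hv hv' => ?_⟩
  exact isGroupLikeElem_mem_of_three (k := k) (B := X.Ordinary h0) (x := v) hB .one hu (hu.mul hu)
    (fun h => by simpa using @hne 0 1 h) (fun h => by simpa using @hne 0 2 h)
    (fun h => by simpa using @hne 1 2 h) ⟨hv, hv'⟩

end Ordinary

/-! ### The twist as a bialgebra involution. -/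

/-- Without odd elements all reassociators act trivially, and orthogonality of `p₊` and `p₋` removes
the mixed terms. Colinearity of the product and coproduct thus becomes compatibility with `t`, read
in the `p₋`-component. -/
theorem tensorCoact_tmul (h0 : ∀ b, X.odd b = 0) (a b : B) :
    (H2 k).tensorCoact X.act X.coact X.act X.coact (a ⊗ₜ b) =
      pPlus k ⊗ₜ (a ⊗ₜ b) + pMinus k ⊗ₜ (X.twist a ⊗ₜ X.twist b) := by
  have h : X.act (pMinus k) = 0 := LinearMap.ext h0
  rw [QuasiBialgebra.tensorCoact, associator_eq _ _ _ (Or.inl h), associatorInv_eq _ _ _ (Or.inl h),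
    associator_eq _ _ _ (Or.inr (Or.inl h))]
  simp only [LinearMap.comp_apply, LinearMap.flip_apply, TensorProduct.mk_apply,
    LinearEquiv.coe_coe, TensorProduct.assoc_tmul, TensorProduct.map_tmul,
    X.braid_tmul, TensorProduct.tmul_add, map_add, TensorProduct.assoc_symm_tmul,
    LinearMap.id_apply, regAct_apply, _root_.mul_one,
    pPlus_mul, pMinus_mul, pPlus_mul_pMinus, pMinus_mul_pPlus, TensorProduct.zero_tmul,
    add_zero, zero_add]

theorem twist_mul (h0 : ∀ b, X.odd b = 0) (a b : B) :
    X.twist (X.mul (a ⊗ₜ b)) = X.mul (X.twist a ⊗ₜ X.twist b) := by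
  have h := X.coact_mul (a ⊗ₜ b)
  rw [X.tensorCoact_tmul h0, X.coact_eq, map_add, TensorProduct.map_tmul,
    TensorProduct.map_tmul] at h
  exact (KC2_tmul_inj h).2

theorem comul_twist (h0 : ∀ b, X.odd b = 0) (b : B) :
    X.comul (X.twist b) = TensorProduct.map X.twist X.twist (X.comul b) := by
  have h1 : ∀ s : B ⊗[k] B, (H2 k).tensorCoact X.act X.coact X.act X.coact s =
      pPlus k ⊗ₜ s + pMinus k ⊗ₜ TensorProduct.map X.twist X.twist s := by
    intro s
    induction s with
    | zero => simp
    | add s t hs ht => simp only [map_add, hs, ht, TensorProduct.tmul_add]; abel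
    | tmul a b => rw [X.tensorCoact_tmul h0, TensorProduct.map_tmul]
  have h := X.coact_comul b
  rw [h1, X.coact_eq, map_add, TensorProduct.map_tmul, TensorProduct.map_tmul] at h
  exact (KC2_tmul_inj h).2

theorem counit_twist (b : B) : X.counit (X.twist b) = X.counit b := by
  have h := congrArg (sign k) (X.coact_counit' b)
  rw [X.coact_eq, map_add, TensorProduct.map_tmul, TensorProduct.map_tmul, map_add,
    TensorProduct.rid_tmul, TensorProduct.rid_tmul, map_add, map_smul, map_smul, map_smul,
    LinearMap.id_apply, LinearMap.id_apply, sign_pMinus, sign_pPlus, map_one] at h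
  simpa using h

/-- The twist fixes or squares a generator. -/
theorem twist_generator (h0 : ∀ b, X.odd b = 0) {u : B} (hu : X.counit u = 1)
    (hΔ : X.comul u = u ⊗ₜ u) (hne : u ≠ X.one)
    (hall : ∀ v, X.counit v = 1 → X.comul v = v ⊗ₜ v →
      v = X.one ∨ v = u ∨ v = X.mul (u ⊗ₜ u)) :
    X.twist u = u ∨ X.twist u = X.mul (u ⊗ₜ u) := by
  rcases hall (X.twist u) (by rw [X.counit_twist, hu])
    (by rw [X.comul_twist h0, hΔ, TensorProduct.map_tmul]) with h | h
  -- The twist is an involution fixing `1`, so `t(u) = 1` would give `u = 1`.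
  · refine absurd ?_ hne
    rw [← X.twist_twist_of_even (h0 u), h, X.twist_one]
  · exact h

/-- The powers of an element, indexed by `C₃`. -/
def cyclicPow (u : B) (x : Multiplicative (ZMod 3)) : B :=
  if x = 1 then X.one else if x = Multiplicative.ofAdd 1 then u else X.mul (u ⊗ₜ u)

/-! ### The isomorphism onto `k[C₃]`. -/

section Iso

variable {X} {u : B}

theorem C3_cases (x : Multiplicative (ZMod 3)) :
    x = 1 ∨ x = Multiplicative.ofAdd 1 ∨ x = Multiplicative.ofAdd 2 := by
  revert x; decide

theorem cyclicPow_one : X.cyclicPow u 1 = X.one := if_pos rfl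

theorem cyclicPow_ofAdd_one : X.cyclicPow u (Multiplicative.ofAdd 1) = u := by
  rw [cyclicPow, if_neg (by decide), if_pos rfl]

theorem cyclicPow_ofAdd_two : X.cyclicPow u (Multiplicative.ofAdd 2) = X.mul (u ⊗ₜ u) := by
  rw [cyclicPow, if_neg (by decide), if_neg (by decide)]

theorem cyclicPow_mul (h0 : ∀ b, X.odd b = 0) (huuu : X.mul (u ⊗ₜ X.mul (u ⊗ₜ u)) = X.one)
    (x y : Multiplicative (ZMod 3)) :
    X.mul (X.cyclicPow u x ⊗ₜ X.cyclicPow u y) = X.cyclicPow u (x * y) := by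
  have hassoc : ∀ a b c, X.mul (X.mul (a ⊗ₜ b) ⊗ₜ c) = X.mul (a ⊗ₜ X.mul (b ⊗ₜ c)) := by
    intro a b c
    rw [X.mul_assoc_tmul, h0]
    simp
  have e11 : (Multiplicative.ofAdd 1 * Multiplicative.ofAdd 1 : Multiplicative (ZMod 3)) =
    Multiplicative.ofAdd 2 := by decide
  have e12 : (Multiplicative.ofAdd 1 * Multiplicative.ofAdd 2 : Multiplicative (ZMod 3)) = 1 := by
    decide
  have e21 : (Multiplicative.ofAdd 2 * Multiplicative.ofAdd 1 : Multiplicative (ZMod 3)) = 1 := by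
    decide
  have e22 : (Multiplicative.ofAdd 2 * Multiplicative.ofAdd 2 : Multiplicative (ZMod 3)) =
    Multiplicative.ofAdd 1 := by decide
  rcases C3_cases x with rfl | rfl | rfl <;> rcases C3_cases y with rfl | rfl | rfl <;>
    simp only [_root_.one_mul, _root_.mul_one, e11, e12, e21, e22, cyclicPow_one, cyclicPow_ofAdd_one,
      cyclicPow_ofAdd_two, X.one_mul, X.mul_one, hassoc, huuu]

theorem cyclicPow_counit (hu : X.counit u = 1) (x : Multiplicative (ZMod 3)) :
    X.counit (X.cyclicPow u x) = 1 := by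
  rcases C3_cases x with rfl | rfl | rfl
  · rw [cyclicPow_one, X.counit_one]
  · rw [cyclicPow_ofAdd_one, hu]
  · rw [cyclicPow_ofAdd_two, X.counit_mul, hu, _root_.one_mul]

theorem cyclicPow_comul (h0 : ∀ b, X.odd b = 0) (hΔ : X.comul u = u ⊗ₜ u)
    (x : Multiplicative (ZMod 3)) :
    X.comul (X.cyclicPow u x) = X.cyclicPow u x ⊗ₜ X.cyclicPow u x := by
  rcases C3_cases x with rfl | rfl | rfl
  · rw [cyclicPow_one, X.comul_one]
  · rw [cyclicPow_ofAdd_one, hΔ]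
  · rw [cyclicPow_ofAdd_two, X.comul_mul_tmul, hΔ,
      X.tensorMul_of_even_any_even _ _ (h0 _) (h0 _)]

theorem cyclicPow_linearIndependent
    (hli : LinearIndependent k ![X.one, u, X.mul (u ⊗ₜ u)]) :
    LinearIndependent k (X.cyclicPow u) := by
  have e : X.cyclicPow u = ![X.one, u, X.mul (u ⊗ₜ u)] ∘
      -- `ZMod 3` unfolds to `Fin 3`, so the exponent itself serves as the index.
      (fun x : Multiplicative (ZMod 3) => (show Fin 3 from x.toAdd)) := by
    ext x
    rcases C3_cases x with rfl | rfl | rfl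
    · exact cyclicPow_one
    · exact cyclicPow_ofAdd_one
    · exact cyclicPow_ofAdd_two
  rw [e]
  exact hli.comp _ fun x y h => h

variable (X u) in
/-- The linear isomorphism from a three-dimensional Hopf algebra onto `k[C₃]` determined by a
generator. -/
def generatorEquiv (hB : finrank k B = 3)
    (hli : LinearIndependent k ![X.one, u, X.mul (u ⊗ₜ u)]) : B ≃ₗ[k] KC3 k :=
  (basisOfLinearIndependentOfCardEqFinrank (cyclicPow_linearIndependent hli)
    (by rw [hB]; rfl)).equiv (MonoidAlgebra.basis (Multiplicative (ZMod 3)) k) (Equiv.refl _)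

theorem generatorEquiv_cyclicPow (hB : finrank k B = 3)
    (hli : LinearIndependent k ![X.one, u, X.mul (u ⊗ₜ u)]) (x : Multiplicative (ZMod 3)) :
    generatorEquiv X u hB hli (X.cyclicPow u x) =
      (MonoidAlgebra.single x 1 : MonoidAlgebra k (Multiplicative (ZMod 3))) := by
  have h := Basis.equiv_apply (b := basisOfLinearIndependentOfCardEqFinrank
    (cyclicPow_linearIndependent hli) (by rw [hB]; rfl)) x
    (MonoidAlgebra.basis (Multiplicative (ZMod 3)) k) (Equiv.refl _)
  rw [coe_basisOfLinearIndependentOfCardEqFinrank, MonoidAlgebra.basis_apply] at h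
  exact h

theorem linearMap_ext_of_cyclicPow (hB : finrank k B = 3)
    (hli : LinearIndependent k ![X.one, u, X.mul (u ⊗ₜ u)]) {M : Type*} [AddCommGroup M]
    [Module k M] {f f' : B →ₗ[k] M} (h : ∀ x, f (X.cyclicPow u x) = f' (X.cyclicPow u x)) :
    f = f' := by
  refine (basisOfLinearIndependentOfCardEqFinrank (cyclicPow_linearIndependent hli)
    (by rw [hB]; rfl)).ext fun x => ?_
  rw [coe_basisOfLinearIndependentOfCardEqFinrank]
  exact h x

/-- An isomorphism onto `k[C₃]` with trivial action and the coaction given by an involution. -/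
def generatorIso (h0 : ∀ b, X.odd b = 0) (hB : finrank k B = 3)
    (hli : LinearIndependent k ![X.one, u, X.mul (u ⊗ₜ u)]) (hu : X.counit u = 1)
    (hΔ : X.comul u = u ⊗ₜ u) (huuu : X.mul (u ⊗ₜ X.mul (u ⊗ₜ u)) = X.one)
    {lam : KC3 k →ₗ[k] KC2 k ⊗[k] KC3 k} {t : KC3 k →ₐc[k] KC3 k}
    (hlam : ∀ c, lam c = pPlus k ⊗ₜ c + pMinus k ⊗ₜ t c) (ht : ∀ c, t (t c) = c)
    (hS : ∀ c, t (HopfAlgebra.antipode k c) = HopfAlgebra.antipode k (t c))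
    (hX : ∀ x, generatorEquiv X u hB hli (X.twist (X.cyclicPow u x)) =
      t (MonoidAlgebra.single x 1 : MonoidAlgebra k (Multiplicative (ZMod 3)))) :
    YDHopfIso X (trivialActionYD lam t hlam ht hS) where
  toLinearEquiv := generatorEquiv X u hB hli
  map_act h b := by
    rw [X.act_eq_of_odd_eq_zero h0, map_smul]
    rfl
  map_coact b := by
    -- Colinearity amounts to intertwining the two twists, and this need only be checked on powers
    -- of the generator.
    have hb : generatorEquiv X u hB hli (X.twist b) = t (generatorEquiv X u hB hli b) := by
      refine LinearMap.congr_fun (f := (generatorEquiv X u hB hli).toLinearMap ∘ₗ X.twist)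
        (g := (t : KC3 k →ₗ[k] KC3 k) ∘ₗ (generatorEquiv X u hB hli).toLinearMap)
        (linearMap_ext_of_cyclicPow hB hli fun x => ?_) b
      exact (hX x).trans (congrArg t (generatorEquiv_cyclicPow hB hli x).symm)
    refine (hlam _).trans ?_
    rw [X.coact_eq, map_add, TensorProduct.map_tmul, TensorProduct.map_tmul, ← hb]
    rfl
  map_mul b b' := by
    refine LinearMap.congr_fun₂ (f := (TensorProduct.mk k B B).compr₂
        ((generatorEquiv X u hB hli).toLinearMap ∘ₗ X.mul))
      (g := (LinearMap.mul k (KC3 k)).compl₁₂ (generatorEquiv X u hB hli).toLinearMap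
        (generatorEquiv X u hB hli).toLinearMap)
      (linearMap_ext_of_cyclicPow hB hli fun x =>
        linearMap_ext_of_cyclicPow hB hli fun y => ?_) b b'
    change generatorEquiv X u hB hli (X.mul (X.cyclicPow u x ⊗ₜ X.cyclicPow u y)) =
      generatorEquiv X u hB hli (X.cyclicPow u x) * generatorEquiv X u hB hli (X.cyclicPow u y)
    rw [cyclicPow_mul h0 huuu, generatorEquiv_cyclicPow, generatorEquiv_cyclicPow,
      generatorEquiv_cyclicPow]
    exact ((MonoidAlgebra.single_mul_single ..).trans (by rw [_root_.mul_one])).symm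
  map_one := by
    refine (congrArg _ (cyclicPow_one (X := X) (u := u)).symm).trans ?_
    exact generatorEquiv_cyclicPow hB hli 1
  map_comul b := by
    refine LinearMap.congr_fun (f := Coalgebra.comul ∘ₗ (generatorEquiv X u hB hli).toLinearMap)
      (g := TensorProduct.map (generatorEquiv X u hB hli).toLinearMap
        (generatorEquiv X u hB hli).toLinearMap ∘ₗ X.comul)
      (linearMap_ext_of_cyclicPow hB hli fun x => ?_) b
    rw [LinearMap.comp_apply, LinearMap.comp_apply, cyclicPow_comul h0 hΔ, TensorProduct.map_tmul,
      LinearEquiv.coe_coe, generatorEquiv_cyclicPow]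
    refine (MonoidAlgebra.comul_single ..).trans ?_
    rw [CommSemiring.comul_apply, TensorProduct.map_tmul]
    rfl
  map_counit b := by
    refine LinearMap.congr_fun (f := Coalgebra.counit ∘ₗ (generatorEquiv X u hB hli).toLinearMap)
      (g := X.counit) (linearMap_ext_of_cyclicPow hB hli fun x => ?_) b
    rw [LinearMap.comp_apply, cyclicPow_counit hu, LinearEquiv.coe_coe, generatorEquiv_cyclicPow]
    exact (MonoidAlgebra.counit_single ..).trans rfl

end Iso

end YDHopfAlgebra

end QuasiHopf

end

/-! ### The classification. -/

theorem mainTheorem4 {k : Type*} [Field k] [IsAlgClosed k] [CharZero k]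
    {B : Type*} [AddCommGroup B] [Module k B] (hdim : Module.finrank k B = 3)
    (X : QuasiHopf.YDHopfAlgebra (QuasiHopf.H2 k).toQuasiBialgebra B) :
    (Nonempty (QuasiHopf.YDHopfIso X (QuasiHopf.BC6 k)) ∨
      Nonempty (QuasiHopf.YDHopfIso X (QuasiHopf.BStar k))) ∧
    ∀ (h : QuasiHopf.KC2 k) (b : B), X.act h b = (QuasiHopf.H2 k).counit h • b := by
  have h0 := X.odd_eq_zero hdim
  refine ⟨?_, X.act_eq_of_odd_eq_zero h0⟩
  obtain ⟨u, hu, hΔ, hli, huuu, hall⟩ := X.exists_generator h0 hdim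
  have hne : u ≠ X.one := fun h => by simpa using hli.injective.ne (show (1 : Fin 3) ≠ 0 by decide) h
  rcases X.twist_generator h0 hu hΔ hne hall with h | h
  · have hX : ∀ x, X.twist (X.cyclicPow u x) = X.cyclicPow u x := by
      intro x
      rcases QuasiHopf.YDHopfAlgebra.C3_cases x with rfl | rfl | rfl
      · rw [QuasiHopf.YDHopfAlgebra.cyclicPow_one, X.twist_one]
      · rw [QuasiHopf.YDHopfAlgebra.cyclicPow_ofAdd_one, h]
      · rw [QuasiHopf.YDHopfAlgebra.cyclicPow_ofAdd_two, X.twist_mul h0, h]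
    refine Or.inl ⟨QuasiHopf.YDHopfAlgebra.generatorIso h0 hdim hli hu hΔ huuu _ _ _ fun x => ?_⟩
    rw [hX, QuasiHopf.YDHopfAlgebra.generatorEquiv_cyclicPow]
    rfl
  · have hX : ∀ x, X.twist (X.cyclicPow u x) = X.cyclicPow u (x ^ 2) := by
      have e1 : (Multiplicative.ofAdd 1 : Multiplicative (ZMod 3)) ^ 2 = Multiplicative.ofAdd 2 := by
        decide
      have e2 : (Multiplicative.ofAdd 2 : Multiplicative (ZMod 3)) ^ 2 = Multiplicative.ofAdd 1 := by
        decide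
      intro x
      rcases QuasiHopf.YDHopfAlgebra.C3_cases x with rfl | rfl | rfl
      · rw [one_pow, QuasiHopf.YDHopfAlgebra.cyclicPow_one, X.twist_one]
      · rw [e1, QuasiHopf.YDHopfAlgebra.cyclicPow_ofAdd_one,
          QuasiHopf.YDHopfAlgebra.cyclicPow_ofAdd_two, h]
      -- Since `u² = t(u)`, the twist sends `u²` to `t(t(u)) = u`, which is `(u²)²`.
      · rw [e2, QuasiHopf.YDHopfAlgebra.cyclicPow_ofAdd_one,
          QuasiHopf.YDHopfAlgebra.cyclicPow_ofAdd_two, ← h, X.twist_twist_of_even (h0 u)]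
    refine Or.inr ⟨QuasiHopf.YDHopfAlgebra.generatorIso h0 hdim hli hu hΔ huuu _ _ _ fun x => ?_⟩
    rw [hX, QuasiHopf.YDHopfAlgebra.generatorEquiv_cyclicPow]
    exact (QuasiHopf.squareHom_single k x).symm
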